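/- **Notation.** $\mathbb Y$ is the Young graph: its vertices are all Young diagrams (including $\varnothing$), and $\mu\nearrow\lambda$ means that $\lambda$ is obtained from $\mu$ by adding one box; $|\lambda|$ is the number of boxes of $\lambda$, $d(\lambda)$ the number of its diagonal boxes, and $\dim\lambda$ the number of paths $\varnothing\nearrow\dots\nearrow\lambda$. A *coherent system* is a function $M\ge 0$ on Young diagrams with $M(\varnothing)=1$ and $$\frac{M(\mu)}{\dim\mu}=\sum_{\lambda:\,\mu\nearrow\lambda}\frac{M(\lambda)}{\dim\lambda}\qquad\text{for all }\mu .$$ For $r_1,\dots,r_n\ge 1$ with $r_1+\dots+r_n=|\lambda|$, $\chi^\lambda_{(r_1,\dots,r_n)}$ is the value of the irreducible character of the symmetric group of degree $|\lambda|$ indexed by $\lambda$ at any permutation with $n$ cycles of lengths $r_1,\dots,r_n$. The Thoma simplex $\Omega$ is the set of triples $\omega=(\alpha,\beta,\gamma)$ with $\alpha_1\ge\alpha_2\ge\dots\ge0$, $\beta_1\ge\beta_2\ge\dots\ge0$, $\gamma\ge0$ and $\sum_i(\alpha_i+\beta_i)+\gamma=1$, with the weakest topology making all $\alpha_i,\beta_i$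 continuous and its Borel $\sigma$-algebra. Put $\widetilde p_1(\omega)=\sum_i\alpha_i+\sum_i\beta_i+\gamma\ (=1)$ and $\widetilde p_k(\omega)=\sum_i\alpha_i^k+(-1)^{k-1}\sum_i\beta_i^k$ for $k\ge2$. For an element $f$ of the algebra $\Lambda=\mathbb R[p_1,p_2,\dots]$ of symmetric functions, $\widetilde f$ is the function on $\Omega$ obtained by replacing each $p_k$ by $\widetilde p_k$; in particular $\widetilde s_\lambda$ comes from the Schur function $s_\lambda=\det[h_{\lambda_i-i+j}]_{i,j=1}^{\ell(\lambda)}$, where $\ell(\lambda)$ is the number of rows of $\lambda$, $\sum_{n\ge0}h_nt^n=\exp\big(\sum_{n\ge1}\tfrac{p_n}{n}t^n\big)$ and $h_m=0$ for $m<0$. A probability measure $P$ on $\Omega$ is the *spectral measure* of $M$ if $M(\lambda)/\dim\lambda=\int_\Omega\widetilde s_\lambda\,dP$ for all $\lambda$. For $\omega\in\Omega$ let $\nu_\omega=\sum_i\alpha_i\,\delta(\alpha_i)+\sum_i\beta_i\,\delta(-\beta_i)+\gamma\,\delta(0)$, a measure on $[-1,1]$. The $n$-th *controlling measure* of $P$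 is the measure $\sigma_n=\int_\Omega\nu_\omega^{\times n}\,P(d\omega)$ on $[-1,1]^n$. **Proposition 3.2.** Let $M$ be a coherent system on the Young graph, $P$ its spectral measure on $\Omega$, and $\sigma_n$ the $n$-th controlling measure of $P$. Then $\sigma_n$ is a probability measure, and for all $l_1,\dots,l_n\in\{0,1,2,\dots\}$ $$\int_{[-1,1]^n}x_1^{l_1}\cdots x_n^{l_n}\,\sigma_n(dx_1\cdots dx_n)=\int_\Omega\widetilde p_{l_1+1}(\omega)\cdots\widetilde p_{l_n+1}(\omega)\,P(d\omega) =\sum_{\substack{\lambda:\ d(\lambda)\le n\\ |\lambda|=l_1+\dots+l_n+n}}\chi^\lambda_{(l_1+1,\dots,l_n+1)}\,\frac{M(\lambda)}{\dim\lambda}.$$ Consequently $\sigma_n$ is determined by the restriction of $M$ to the diagrams with at most $n$ diagonal boxes: if $M'$ is another coherent system, with spectral measure $P'$, and $M'(\lambda)=M(\lambda)$ whenever $d(\lambda)\le n$, then the $n$-th controlling measures of $P'$ and $P$ coincide. -/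

import Mathlib

open MeasureTheory

noncomputable section

/-! ### The Young graph -/

namespace YoungGraph

/-- The edge relation `μ ↗ lam`: the diagram `lam` contains `μ` and has exactly one more box. -/
def Edge (μ lam : YoungDiagram) : Prop :=
  μ ≤ lam ∧ lam.card = μ.card + 1

/-- The dimension of a diagram: the number of oriented paths in the Young graph from the empty
diagram to `lam`.  Every edge adds one box, so such a path has `|lam|` edges. -/
def dim (lam : YoungDiagram) : ℕ :=
  Nat.card {f : Fin (lam.card + 1) → YoungDiagram //
    f 0 = ⊥ ∧ f (Fin.last _) = lam ∧ ∀ i : Fin lam.card, Edge (f i.castSucc) (f i.succ)}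

/-- There are only finitely many diagrams with `n` boxes. -/
theorem finite_level (n : ℕ) : {lam : YoungDiagram | lam.card = n}.Finite := by
  apply Set.Finite.of_finite_image (f := YoungDiagram.cells)
  · apply (Finset.finite_toSet (Finset.range n ×ˢ Finset.range n).powerset).subset
    rintro _ ⟨lam, hl, rfl⟩
    have hl' : lam.cells.card = n := hl
    simp only [Finset.coe_powerset, Set.mem_preimage, Set.mem_powerset_iff, Finset.coe_subset]
    rintro ⟨i, j⟩ hc
    have hc' : (i, j) ∈ lam := hc
    rw [Finset.mem_product, Finset.mem_range, Finset.mem_range]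
    constructor
    · have h1 : i < lam.colLen j := YoungDiagram.mem_iff_lt_colLen.1 hc'
      have h2 : lam.colLen j ≤ lam.cells.card := by
        rw [YoungDiagram.colLen_eq_card]
        exact Finset.card_le_card (Finset.filter_subset _ _)
      simp only
      omega
    · have h1 : j < lam.rowLen i := YoungDiagram.mem_iff_lt_rowLen.1 hc'
      have h2 : lam.rowLen i ≤ lam.cells.card := by
        rw [YoungDiagram.rowLen_eq_card]
        exact Finset.card_le_card (Finset.filter_subset _ _)
      simp only
      omega
  · intro a _ b _ h
    exact YoungDiagram.ext h

/-- The `n`-th floor of the Young graph: the finite set of diagrams with `n` boxes. -/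
def level (n : ℕ) : Finset YoungDiagram := (finite_level n).toFinset

theorem mem_level {n : ℕ} {lam : YoungDiagram} : lam ∈ level n ↔ lam.card = n := by
  simp [level]

open Classical in
/-- A coherent system of distributions on the Young graph: a nonnegative function `M` on diagrams
with `M ∅ = 1` such that `M lam / dim lam` is harmonic. -/
structure IsCoherentSystem (M : YoungDiagram → ℝ) : Prop where
  nonneg : ∀ lam, 0 ≤ M lam
  normalized : M ⊥ = 1
  harmonic : ∀ μ : YoungDiagram,
    M μ / (dim μ : ℝ) = ∑ lam ∈ (level (μ.card + 1)).filter (fun lam => Edge μ lam),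
      M lam / (dim lam : ℝ)

/-- The number `d(lam)` of diagonal boxes. -/
def diagLen (lam : YoungDiagram) : ℕ := (lam.cells.filter (fun c => c.1 = c.2)).card

end YoungGraph

/-! ### Irreducible characters of the symmetric groups -/

namespace SymmetricGroup

/-- The symmetric group of degree `|lam|`, realized as the group of permutations of the boxes of
the diagram `lam`. -/
abbrev BoxPerm (lam : YoungDiagram) : Type := Equiv.Perm lam.cells

open Classical in
/-- The row symmetrizer: the sum of the permutations which preserve each row. -/
def rowSymmetrizer (lam : YoungDiagram) : MonoidAlgebra ℝ (BoxPerm lam) :=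
  ∑ g ∈ (Finset.univ : Finset (BoxPerm lam)).filter
      (fun g => ∀ c : lam.cells, (g c).1.1 = c.1.1),
    MonoidAlgebra.of ℝ _ g

open Classical in
/-- The column antisymmetrizer: the signed sum of the permutations which preserve each column. -/
def colAntisymmetrizer (lam : YoungDiagram) : MonoidAlgebra ℝ (BoxPerm lam) :=
  ∑ g ∈ (Finset.univ : Finset (BoxPerm lam)).filter
      (fun g => ∀ c : lam.cells, (g c).1.2 = c.1.2),
    ((Equiv.Perm.sign g : ℤ) : ℝ) • MonoidAlgebra.of ℝ _ g

/-- The Young symmetrizer of the diagram `lam`. -/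
def youngSymmetrizer (lam : YoungDiagram) : MonoidAlgebra ℝ (BoxPerm lam) :=
  rowSymmetrizer lam * colAntisymmetrizer lam

/-- The Specht module: the left ideal of the group algebra generated by the Young symmetrizer.
It is the irreducible module indexed by `lam`; it is absolutely irreducible, so its character is
the same over `ℝ` and over `ℂ`. -/
def spechtModule (lam : YoungDiagram) : Submodule ℝ (MonoidAlgebra ℝ (BoxPerm lam)) :=
  LinearMap.range (LinearMap.mulRight ℝ (youngSymmetrizer lam))

theorem mul_mem_spechtModule (lam : YoungDiagram) (y : MonoidAlgebra ℝ (BoxPerm lam)) :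
    ∀ x ∈ spechtModule lam, LinearMap.mulLeft ℝ y x ∈ spechtModule lam := by
  rintro _ ⟨z, rfl⟩
  exact ⟨y * z, by simp [mul_assoc]⟩

/-- The representation of the symmetric group on the Specht module, by left multiplication. -/
def spechtRep (lam : YoungDiagram) : Representation ℝ (BoxPerm lam) (spechtModule lam) where
  toFun g := (LinearMap.mulLeft ℝ (MonoidAlgebra.of ℝ (BoxPerm lam) g)).restrict
    (mul_mem_spechtModule lam _)
  map_one' := by
    ext x
    simp [LinearMap.restrict_apply]
  map_mul' g h := by
    apply LinearMap.ext
    intro x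
    apply Subtype.ext
    simp only [LinearMap.restrict_apply, map_mul, LinearMap.mulLeft_apply, Module.End.mul_apply,
      mul_assoc]

/-- The irreducible character `χ^lam`. -/
def irrChar (lam : YoungDiagram) (g : BoxPerm lam) : ℝ := (spechtRep lam).character g

open Classical in
/-- The value `χ^lam_r` of the irreducible character `χ^lam` at any permutation whose multiset of
cycle lengths (fixed points included) is `r`; used only when `r` consists of positive numbers with
sum `|lam|` (it is set to `0` if there is no such permutation). -/
def irrCharAt (lam : YoungDiagram) (r : Multiset ℕ) : ℝ :=
  if h : ∃ g : BoxPerm lam, g.partition.parts = r then irrChar lam h.choose else 0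

/-- The value at a cycle type is the value at any permutation of this cycle type. -/
theorem irrCharAt_eq (lam : YoungDiagram) (g : BoxPerm lam) :
    irrCharAt lam g.partition.parts = irrChar lam g := by
  have h : ∃ k : BoxPerm lam, k.partition.parts = g.partition.parts := ⟨g, rfl⟩
  rw [irrCharAt, dif_pos h]
  obtain ⟨k, hk⟩ := isConj_iff.1
    (Equiv.Perm.partition_eq_of_isConj.2 (Nat.Partition.ext h.choose_spec))
  exact ((spechtRep lam).char_conj _ k).symm.trans (congrArg _ hk)

end SymmetricGroup

/-! ### Symmetric functions -/

/-- The algebra `Λ = ℝ[p₁, p₂, …]` of symmetric functions; the variable `X k` is the power sum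
`p_{k+1}`. -/
abbrev SymFun : Type := MvPolynomial ℕ ℝ

namespace SymFun

/-- The series `∑_{n ≥ 1} (p_n / n) t^n`. -/
def powerSumSeries : PowerSeries SymFun :=
  PowerSeries.mk fun n =>
    if n = 0 then 0 else MvPolynomial.C (1 / (n : ℝ)) * MvPolynomial.X (n - 1)

/-- The complete symmetric functions, `∑_n h_n t^n = exp (∑_{n ≥ 1} (p_n / n) t^n)`. -/
def complete (n : ℕ) : SymFun :=
  PowerSeries.coeff n ((PowerSeries.exp SymFun).subst powerSumSeries)

/-- `h_m` for an integer `m`, with `h_m = 0` for `m < 0`. -/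
def completeInt (m : ℤ) : SymFun := if m < 0 then 0 else complete m.toNat

/-- The Schur function `s_lam = det [h_{lam_i - i + j}]`, of order `ℓ(lam)`. -/
def schur (lam : YoungDiagram) : SymFun :=
  Matrix.det (Matrix.of fun i j : Fin (lam.colLen 0) =>
    completeInt ((lam.rowLen i : ℤ) - (i : ℤ) + (j : ℤ)))

end SymFun

/-! ### The Thoma simplex -/

/-- The Thoma simplex `Ω`: triples `(α, β, γ)` with `α₁ ≥ α₂ ≥ … ≥ 0`, `β₁ ≥ β₂ ≥ … ≥ 0`, `γ ≥ 0`
and `∑ (α_i + β_i) + γ = 1` (sequences are indexed from `0`). -/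
@[ext]
structure ThomaSimplex where
  α : ℕ → ℝ
  β : ℕ → ℝ
  γ : ℝ
  α_anti : Antitone α
  β_anti : Antitone β
  α_nonneg : ∀ i, 0 ≤ α i
  β_nonneg : ∀ i, 0 ≤ β i
  γ_nonneg : 0 ≤ γ
  hasSum : HasSum (fun i => α i + β i) (1 - γ)

namespace ThomaSimplex

/-- The weakest topology in which the coordinates `α_i` and `β_i` are continuous. -/
instance : TopologicalSpace ThomaSimplex :=
  TopologicalSpace.induced (fun ω => (ω.α, ω.β)) inferInstance

instance : MeasurableSpace ThomaSimplex := borel ThomaSimplex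

instance : BorelSpace ThomaSimplex := ⟨rfl⟩

theorem add_le_one (ω : ThomaSimplex) (i : ℕ) : ω.α i + ω.β i ≤ 1 := by
  have h := le_hasSum ω.hasSum i fun j _ => add_nonneg (ω.α_nonneg j) (ω.β_nonneg j)
  have := ω.γ_nonneg
  linarith

/-- The extended power sums `p̃_n`, for `n ≥ 1`. -/
def extPowerSum (n : ℕ) (ω : ThomaSimplex) : ℝ :=
  if n = 1 then (∑' i, ω.α i) + (∑' i, ω.β i) + ω.γ
  else (∑' i, ω.α i ^ n) + (-1) ^ (n - 1) * ∑' i, ω.β i ^ n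

/-- The extended version `f̃` of a symmetric function `f`: replace each `p_n` by `p̃_n`. -/
def extend (f : SymFun) (ω : ThomaSimplex) : ℝ :=
  MvPolynomial.aeval (fun k => extPowerSum (k + 1) ω) f

/-- The point `α_i` of `[-1, 1]`. -/
def posPoint (ω : ThomaSimplex) (i : ℕ) : Set.Icc (-1 : ℝ) 1 :=
  ⟨ω.α i, by have := ω.α_nonneg i; linarith,
    by have := ω.β_nonneg i; have := ω.add_le_one i; linarith⟩

/-- The point `-β_i` of `[-1, 1]`. -/
def negPoint (ω : ThomaSimplex) (i : ℕ) : Set.Icc (-1 : ℝ) 1 :=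
  ⟨-ω.β i, by have := ω.α_nonneg i; have := ω.add_le_one i; linarith,
    by have := ω.β_nonneg i; linarith⟩

/-- The Thoma measure `ν_ω = ∑ α_i δ(α_i) + ∑ β_i δ(-β_i) + γ δ(0)` on `[-1, 1]`. -/
def thomaMeasure (ω : ThomaSimplex) : Measure (Set.Icc (-1 : ℝ) 1) :=
  Measure.sum (fun i => ENNReal.ofReal (ω.α i) • Measure.dirac (ω.posPoint i))
    + Measure.sum (fun i => ENNReal.ofReal (ω.β i) • Measure.dirac (ω.negPoint i))
    + ENNReal.ofReal ω.γ • Measure.dirac ⟨0, by norm_num⟩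

/-- The `n`-th controlling measure `σ_n = ∫_Ω ν_ω × ⋯ × ν_ω P(dω)` on `[-1, 1]^n`. -/
def controllingMeasure (P : Measure ThomaSimplex) (n : ℕ) :
    Measure (Fin n → Set.Icc (-1 : ℝ) 1) :=
  P.bind fun ω => Measure.pi fun _ : Fin n => thomaMeasure ω

end ThomaSimplex

/-- `P` is the spectral measure of `M`: a probability measure on the Thoma simplex such that
`M(lam) / dim lam = ∫ s̃_lam dP` for all diagrams `lam`. -/
structure IsSpectralMeasure (M : YoungDiagram → ℝ) (P : Measure ThomaSimplex) : Prop where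
  isProb : IsProbabilityMeasure P
  repr : ∀ lam : YoungDiagram,
    M lam / (YoungGraph.dim lam : ℝ) = ∫ ω, ThomaSimplex.extend (SymFun.schur lam) ω ∂P

end

/-! For fixed ω the l-th moment of ν_ω is p̃_{l+1}(ω): the atom at α_i gives α_i·α_i^l, the atom at
-β_i gives β_i(-β_i)^l, and the atom at 0 contributes only for l = 0. Fubini for ν_ω^{×n}, followed
by integration over P, gives the first equality.

The second is the Frobenius formula p_{r_1}⋯p_{r_n} = ∑ χ^λ_r s_λ, carried to Ω by the algebra
homomorphism `extend` and integrated term by term (`prod_X_eq_sum`, `integral_prod_extPowerSum`).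
Diagrams with d(λ) > n drop out: in the Jacobi–Trudi determinant the d(λ) rows that meet the
diagonal contain only h_k with k > 0, so every power sum monomial of s_λ has at least d(λ) factors
(`jacobiTrudi_mem_pow_idealOfVars`). The measure is then recovered from its moments by
Stone–Weierstrass on the cube (`eq_of_moments_eq`).

The bulk of the work is the Frobenius formula for characters defined through Young symmetrizers. In
the Hall inner product the adjoint of multiplication by h_k lowers indices in a Jacobi–Trudi
determinant; this makes Schur functions triangular against products of the h_k, hence orthonormal,
and a count of diagrams makes them a basis (`monomial_eq_sum_schur`). On the group side, von
Neumann's lemma shows that χ^λ has norm 1, that it averages to 1 over the row group, and that it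
averages to 0 over the Young subgroups of lexicographically larger type. So ch χ^λ and s_λ both have
norm 1 and their inner product is 1, and definiteness forces them to coincide (`charMap_irrChar`).
-/

namespace SymFun

open MvPolynomial

/-! ### Newton's identities and the coefficients of the complete symmetric functions -/

theorem hasSubst_powerSumSeries : PowerSeries.HasSubst powerSumSeries :=
  PowerSeries.HasSubst.of_constantCoeff_zero' (by
    rw [← PowerSeries.coeff_zero_eq_constantCoeff_apply]
    simp [powerSumSeries])

theorem coeff_derivative_powerSumSeries (n : ℕ) :
    PowerSeries.coeff n (PowerSeries.derivative SymFun powerSumSeries) = X n := by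
  rw [PowerSeries.coeff_derivative, powerSumSeries, PowerSeries.coeff_mk]
  have h : ((n : SymFun) + 1) = C ((n : ℝ) + 1) := by simp
  have h2 : ((n : ℝ) + 1) ≠ 0 := by positivity
  rw [if_neg (Nat.succ_ne_zero n), h, mul_right_comm, ← C_mul]
  push_cast
  rw [one_div_mul_cancel h2]
  simp

theorem complete_zero : complete 0 = 1 := by
  have h0 : PowerSeries.constantCoeff powerSumSeries = 0 := by
    rw [← PowerSeries.coeff_zero_eq_constantCoeff_apply]
    simp [powerSumSeries]
  have h1 := PowerSeries.constantCoeff_subst_eq_zero (a := powerSumSeries) h0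
    (PowerSeries.exp SymFun - 1) (by simp)
  rw [complete, PowerSeries.coeff_zero_eq_constantCoeff_apply]
  have h2 : PowerSeries.subst powerSumSeries (PowerSeries.exp SymFun)
      = PowerSeries.subst powerSumSeries (PowerSeries.exp SymFun - 1) + 1 := by
    rw [← PowerSeries.coe_substAlgHom hasSubst_powerSumSeries]
    simp
  rw [h2, map_add]
  change MvPowerSeries.constantCoeff _ + _ = _
  rw [h1]
  simp

/-- Differentiating H = exp P gives H' = P'H; this is the coefficient of t^n. -/
theorem newton (n : ℕ) :
    ((n : SymFun) + 1) * complete (n + 1) =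
      ∑ r ∈ Finset.range (n + 1), X r * complete (n - r) := by
  have h := congrArg (PowerSeries.coeff n)
    (PowerSeries.derivative_subst (f := PowerSeries.exp SymFun) hasSubst_powerSumSeries)
  rw [PowerSeries.derivative_exp, PowerSeries.coeff_derivative, mul_comm (PowerSeries.subst _ _),
    PowerSeries.coeff_mul, Finset.Nat.sum_antidiagonal_eq_sum_range_succ_mk] at h
  simp only [coeff_derivative_powerSumSeries] at h
  rw [mul_comm]
  exact h

/-- The degree of the monomial `p^m`, where `X k = p_{k+1}` has degree `k + 1`. -/
noncomputable abbrev wt : (ℕ →₀ ℕ) →+ ℕ := Finsupp.weight fun k : ℕ => k + 1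

/-- The order `∏ (k+1)^{m_k} m_k!` of the centralizer of a permutation with `m_k` cycles of
length `k + 1`. -/
noncomputable def zee (m : ℕ →₀ ℕ) : ℝ := m.prod fun k a => ((k : ℝ) + 1) ^ a * (a.factorial : ℝ)

theorem zee_pos (m : ℕ →₀ ℕ) : 0 < zee m :=
  Finset.prod_pos fun k _ => by positivity

theorem zee_zero : zee 0 = 1 := by simp [zee]

/-- This ratio drives both the formula for the coefficients of h_n and the adjointness of p_{r+1}
and its derivative. -/
theorem zee_add_single (m : ℕ →₀ ℕ) (r : ℕ) :
    zee (m + Finsupp.single r 1) = zee m * (((r : ℝ) + 1) * ((m r : ℝ) + 1)) := by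
  classical
  set S := insert r m.support
  have h1 : zee m = ∏ k ∈ S, ((k : ℝ) + 1) ^ m k * ((m k).factorial : ℝ) :=
    Finsupp.prod_of_support_subset _ (Finset.subset_insert _ _) _ (by simp)
  have h2 : zee (m + Finsupp.single r 1) = ∏ k ∈ S, ((k : ℝ) + 1) ^ (m + Finsupp.single r 1 : ℕ →₀ ℕ) k *
      (((m + Finsupp.single r 1 : ℕ →₀ ℕ) k).factorial : ℝ) := by
    refine Finsupp.prod_of_support_subset _ (fun k hk => ?_) _ (by simp)
    by_cases hkr : k = r
    · simp [S, hkr]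
    · simp only [Finsupp.mem_support_iff, Finsupp.add_apply, Finsupp.single_apply,
        if_neg (Ne.symm hkr), add_zero] at hk
      simp [S, hk]
  have hr : r ∈ S := Finset.mem_insert_self _ _
  rw [h1, h2, ← Finset.mul_prod_erase _ _ hr, ← Finset.mul_prod_erase S _ hr]
  have h3 : ∀ k ∈ S.erase r, ((k : ℝ) + 1) ^ (m + Finsupp.single r 1 : ℕ →₀ ℕ) k *
      (((m + Finsupp.single r 1 : ℕ →₀ ℕ) k).factorial : ℝ) =
      ((k : ℝ) + 1) ^ m k * ((m k).factorial : ℝ) := by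
    intro k hk
    have : r ≠ k := (Finset.ne_of_mem_erase hk).symm
    simp [this]
  rw [Finset.prod_congr rfl h3]
  simp only [Finsupp.add_apply, Finsupp.single_eq_same, Nat.factorial_succ, pow_succ]
  push_cast
  ring

theorem wt_single (r a : ℕ) : wt (Finsupp.single r a) = a * (r + 1) := by
  simp [Finsupp.weight_single]

theorem wt_eq_sum (m : ℕ →₀ ℕ) : wt m = ∑ k ∈ m.support, m k * (k + 1) := by
  simp [Finsupp.weight_apply, Finsupp.sum]

theorem lt_wt_of_mem_support {m : ℕ →₀ ℕ} {r : ℕ} (h : r ∈ m.support) : r + 1 ≤ wt m := by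
  rw [wt_eq_sum]
  refine le_trans ?_ (Finset.single_le_sum (f := fun k => m k * (k + 1)) (fun _ _ => zero_le) h)
  exact Nat.le_mul_of_pos_left _ (Nat.pos_of_ne_zero (Finsupp.mem_support_iff.1 h))

theorem wt_eq_zero {m : ℕ →₀ ℕ} : wt m = 0 ↔ m = 0 := by
  refine ⟨fun h => ?_, fun h => by simp [h]⟩
  by_contra hm
  obtain ⟨r, hr⟩ := Finsupp.support_nonempty_iff.2 hm
  have := lt_wt_of_mem_support hr
  omega

/-- Induction by Newton's identity: removing one factor X r from p^m turns 1/z_m into (r+1)m_r/z_m,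
and the numbers (r+1)m_r add up to the weight n + 1. -/
theorem coeff_complete (n : ℕ) (m : ℕ →₀ ℕ) :
    coeff m (complete n) = if wt m = n then (zee m)⁻¹ else 0 := by
  induction n using Nat.strong_induction_on generalizing m with
  | _ n ih =>
  rcases n with _ | n
  · rw [complete_zero, coeff_one]
    simp only [wt_eq_zero, eq_comm (a := (0 : ℕ →₀ ℕ))]
    split_ifs with h
    · rw [h, zee_zero, inv_one]
    · rfl
  · have hn := congrArg (coeff m) (newton n)
    have h1 : ((n : SymFun) + 1) = C ((n : ℝ) + 1) := by simp
    rw [h1, coeff_C_mul, coeff_sum] at hn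
    have h2 : ∀ r ∈ Finset.range (n + 1), coeff m (X r * complete (n - r)) =
        if r ∈ m.support then
          (if wt m = n + 1 then (zee m)⁻¹ * (((r : ℝ) + 1) * (m r : ℝ)) else 0) else 0 := by
      intro r hr
      have hr' : r < n + 1 := Finset.mem_range.1 hr
      rw [mul_comm, coeff_mul_X']
      split_ifs with hm hw
      · obtain ⟨m', rfl⟩ : ∃ m', m = m' + Finsupp.single r 1 :=
          ⟨m - Finsupp.single r 1, (tsub_add_cancel_of_le (by
            simpa using Nat.one_le_iff_ne_zero.2 (Finsupp.mem_support_iff.1 hm))).symm⟩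
        rw [add_tsub_cancel_right, ih _ (by omega), zee_add_single]
        rw [map_add, wt_single] at hw
        rw [if_pos (by omega)]
        have := (zee_pos m').ne'
        simp only [Finsupp.add_apply, Finsupp.single_eq_same]
        push_cast
        have h3 : ((r : ℝ) + 1) ≠ 0 := by positivity
        have h4 : ((m' r : ℝ) + 1) ≠ 0 := by positivity
        field_simp
      · obtain ⟨m', rfl⟩ : ∃ m', m = m' + Finsupp.single r 1 :=
          ⟨m - Finsupp.single r 1, (tsub_add_cancel_of_le (by
            simpa using Nat.one_le_iff_ne_zero.2 (Finsupp.mem_support_iff.1 hm))).symm⟩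
        rw [add_tsub_cancel_right, ih _ (by omega)]
        rw [map_add, wt_single] at hw
        rw [if_neg (by omega)]
      · rfl
    rw [Finset.sum_congr rfl h2] at hn
    have hpos : ((n : ℝ) + 1) ≠ 0 := by positivity
    split_ifs with hw
    · have h3 : (∑ r ∈ Finset.range (n + 1), if r ∈ m.support then
          (if wt m = n + 1 then (zee m)⁻¹ * (((r : ℝ) + 1) * (m r : ℝ)) else 0) else 0) =
          (zee m)⁻¹ * ((n : ℝ) + 1) := by
        simp only [if_pos hw]
        rw [← Finset.sum_filter]
        have h4 : (Finset.range (n + 1)).filter (fun r => r ∈ m.support) = m.support := by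
          ext r
          simp only [Finset.mem_filter, Finset.mem_range, and_iff_right_iff_imp]
          intro hr
          have := lt_wt_of_mem_support hr
          omega
        rw [h4, ← Finset.mul_sum]
        congr 1
        have := wt_eq_sum m
        rw [hw] at this
        exact_mod_cast (this.trans (Finset.sum_congr rfl fun _ _ => mul_comm _ _)).symm
      rw [h3, mul_comm] at hn
      exact mul_right_cancel₀ hpos hn
    · simp only [if_neg hw, ite_self, Finset.sum_const_zero] at hn
      exact (mul_eq_zero.1 hn).resolve_left hpos

/-! ### The Hall inner product -/

/-- The Hall inner product, for which the monomials `p^m` are orthogonal of square norm `z_m`. -/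
noncomputable def pairing : SymFun →ₗ[ℝ] SymFun →ₗ[ℝ] ℝ :=
  (basisMonomials ℕ ℝ).constr ℝ fun m => zee m • lcoeff ℝ m

theorem pairing_monomial (m : ℕ →₀ ℕ) (a : ℝ) (g : SymFun) :
    pairing (monomial m a) g = a * (zee m * coeff m g) := by
  have h : (monomial m a : SymFun) = a • basisMonomials ℕ ℝ m := by
    rw [coe_basisMonomials, smul_monomial, smul_eq_mul, mul_one]
  rw [h, map_smul, pairing, Module.Basis.constr_basis]
  simp

theorem pairing_eq_sum (f g : SymFun) :
    pairing f g = ∑ m ∈ f.support, zee m * coeff m f * coeff m g := by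
  conv_lhs => rw [f.as_sum]
  rw [map_sum, LinearMap.sum_apply]
  refine Finset.sum_congr rfl fun m _ => ?_
  rw [pairing_monomial]
  ring

theorem pairing_comm (f g : SymFun) : pairing f g = pairing g f := by
  classical
  have h : ∀ f g : SymFun, pairing f g =
      ∑ m ∈ f.support ∪ g.support, zee m * coeff m f * coeff m g := by
    intro f g
    rw [pairing_eq_sum]
    refine Finset.sum_subset Finset.subset_union_left fun m _ hm => ?_
    rw [notMem_support_iff.1 hm]
    simp
  rw [h f g, h g f, Finset.union_comm]
  exact Finset.sum_congr rfl fun m _ => by ring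

/-- Definiteness: the form is diagonal with positive entries z_m over ℝ. -/
theorem eq_zero_of_pairing_self {f : SymFun} (h : pairing f f = 0) : f = 0 := by
  rw [pairing_eq_sum, Finset.sum_eq_zero_iff_of_nonneg] at h
  · ext m
    by_contra hm
    have hm' : coeff m f ≠ 0 := by simpa using hm
    have := h m (mem_support_iff.2 hm')
    have hz := (zee_pos m).ne'
    simp_all
  · intro m _
    have := zee_pos m
    rw [mul_assoc]
    exact mul_nonneg this.le (mul_self_nonneg _)

theorem pairing_X_mul (r : ℕ) (f g : SymFun) :
    pairing (X r * f) g = pairing f (((r : ℝ) + 1) • pderiv r g) := by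
  induction f using MvPolynomial.induction_on' with
  | monomial m a =>
    rw [mul_comm, ← pow_one (X r), ← monomial_add_single, pairing_monomial, pairing_monomial,
      zee_add_single, coeff_smul, coeff_pderiv, smul_eq_mul]
    ring
  | add p q hp hq => rw [mul_add, map_add, LinearMap.add_apply, hp, hq, map_add,
      LinearMap.add_apply]

/-- The homomorphism `p_k ↦ p_k + t^k`. Its coefficients are the adjoints of multiplication by the
complete symmetric functions. -/
noncomputable def shift : SymFun →ₐ[ℝ] Polynomial SymFun :=
  aeval fun k => Polynomial.C (X k) + Polynomial.X ^ (k + 1)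

theorem shift_X (k : ℕ) : shift (X k) = Polynomial.C (X k) + Polynomial.X ^ (k + 1) := by
  simp [shift]

theorem coeff_zero_shift (g : SymFun) : (shift g).coeff 0 = g := by
  induction g using MvPolynomial.induction_on with
  | C a => simp
  | add p q hp hq => simp [hp, hq]
  | mul_X p k hp => rw [map_mul, Polynomial.mul_coeff_zero, hp, shift_X]; simp

theorem coeff_shift_mul_X (g : SymFun) (k s : ℕ) :
    (shift (g * X s)).coeff k =
      (shift g).coeff k * X s + if s + 1 ≤ k then (shift g).coeff (k - (s + 1)) else 0 := by
  rw [map_mul, shift_X, mul_add, Polynomial.coeff_add, Polynomial.coeff_mul_C,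
    Polynomial.coeff_mul_X_pow']

/-- By Taylor's formula `shift` is exp(∑ t^{r+1} ∂_r), so its t-derivative applies ∑ (r+1) t^r ∂_r
first. This recursion mirrors Newton's identity on the adjoint side. -/
theorem coeff_shift_succ (g : SymFun) (k : ℕ) :
    ((k : ℝ) + 1) • (shift g).coeff (k + 1) =
      ∑ r ∈ Finset.range (k + 1), (shift (((r : ℝ) + 1) • pderiv r g)).coeff (k - r) := by
  induction g using MvPolynomial.induction_on generalizing k with
  | C a => simp
  | add p q hp hq =>
    simp only [map_add, smul_add, Polynomial.coeff_add, Finset.sum_add_distrib, hp, hq]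
  | mul_X g s ih =>
    -- Leibniz for g · X s: two terms differentiate g, one for each summand of the shifted variable,
    -- and the last differentiates X s, hence only r = s.
    have h1 : ∀ r ∈ Finset.range (k + 1),
        (shift (((r : ℝ) + 1) • pderiv r (g * X s))).coeff (k - r) =
        (shift (((r : ℝ) + 1) • pderiv r g)).coeff (k - r) * X s +
        ((if r + (s + 1) ≤ k then
          (shift (((r : ℝ) + 1) • pderiv r g)).coeff (k - (s + 1) - r) else 0) +
        if r = s then ((s : ℝ) + 1) • (shift g).coeff (k - s) else 0) := by
      intro r hr
      have hr' : r < k + 1 := Finset.mem_range.1 hr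
      have h2 : ((r : ℝ) + 1) • pderiv r (g * X s) =
          (((r : ℝ) + 1) • pderiv r g) * X s + if r = s then ((s : ℝ) + 1) • g else 0 := by
        rw [Derivation.leibniz, pderiv_X, smul_eq_mul, smul_eq_mul]
        by_cases h : r = s
        · subst h
          simp only [Pi.single_eq_same, mul_one, if_true, smul_add]
          rw [add_comm, mul_comm (X r), smul_mul_assoc]
        · rw [Pi.single_eq_of_ne (Ne.symm h), mul_zero, zero_add, if_neg h, add_zero,
            mul_comm (X s), smul_mul_assoc]
      rw [h2, map_add, Polynomial.coeff_add, coeff_shift_mul_X, add_assoc]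
      congr 1
      congr 1
      · refine if_congr (by omega) ?_ rfl
        congr 1
        omega
      · split_ifs with h
        · rw [map_smul, Polynomial.coeff_smul, h]
        · simp
    rw [Finset.sum_congr rfl h1, Finset.sum_add_distrib, Finset.sum_add_distrib, ← Finset.sum_mul,
      ← ih, coeff_shift_mul_X, smul_add, smul_mul_assoc]
    congr 1
    rw [Finset.sum_ite_eq' (Finset.range (k + 1)) s]
    by_cases hs : s ≤ k
    · rw [if_pos (by omega), if_pos (Finset.mem_range.2 (by omega)),
        show k + 1 - (s + 1) = k - s by omega]
      rcases Nat.eq_or_lt_of_le hs with rfl | hlt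
      · rw [Finset.sum_eq_zero (fun r _ => if_neg (by omega)), zero_add]
      · have h3 := ih (k - (s + 1))
        rw [show k - (s + 1) + 1 = k - s by omega] at h3
        rw [← Finset.sum_filter]
        have h4 : (Finset.range (k + 1)).filter (fun r => r + (s + 1) ≤ k) =
            Finset.range (k - s) := by
          ext r
          simp only [Finset.mem_filter, Finset.mem_range]
          omega
        rw [h4, ← h3, ← add_smul]
        congr 1
        have : k = (k - (s + 1)) + s + 1 := by omega
        have h5 : (k : ℝ) = ((k - (s + 1) : ℕ) : ℝ) + s + 1 := by exact_mod_cast this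
        rw [h5]
        ring
    · rw [if_neg (by omega), if_neg (by simpa using hs), add_zero, smul_zero]
      rw [Finset.sum_eq_zero (fun r _ => if_neg (by omega))]

/-- After multiplication by k, Newton's identity on the left and `coeff_shift_succ` on the right
match term by term through `pairing_X_mul`. -/
theorem pairing_complete_mul (k : ℕ) (f g : SymFun) :
    pairing (complete k * f) g = pairing f ((shift g).coeff k) := by
  induction k using Nat.strong_induction_on generalizing f g with
  | _ k ih =>
  rcases k with _ | k
  · rw [complete_zero, one_mul, coeff_zero_shift]
  · have hpos : ((k : ℝ) + 1) ≠ 0 := by positivity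
    apply mul_left_cancel₀ hpos
    have h1 : ((k : ℝ) + 1) * pairing (complete (k + 1) * f) g =
        pairing ((((k : SymFun) + 1) * complete (k + 1)) * f) g := by
      have : ((k : SymFun) + 1) * complete (k + 1) = ((k : ℝ) + 1) • complete (k + 1) := by
        rw [smul_eq_C_mul]; simp
      rw [this, smul_mul_assoc, map_smul, LinearMap.smul_apply, smul_eq_mul]
    have h2 : ((k : ℝ) + 1) * pairing f ((shift g).coeff (k + 1)) =
        pairing f (((k : ℝ) + 1) • (shift g).coeff (k + 1)) := by
      rw [map_smul, smul_eq_mul]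
    rw [h1, h2, newton, coeff_shift_succ, Finset.sum_mul, map_sum, LinearMap.sum_apply, map_sum]
    refine Finset.sum_congr rfl fun r hr => ?_
    have := Finset.mem_range.1 hr
    rw [mul_assoc, pairing_X_mul, ih _ (by omega)]

/-! ### Jacobi–Trudi determinants -/

theorem completeInt_natCast (n : ℕ) : completeInt n = complete n := by
  simp [completeInt]

theorem completeInt_of_neg {a : ℤ} (h : a < 0) : completeInt a = 0 := if_pos h

theorem completeInt_zero : completeInt 0 = 1 := by
  rw [← Nat.cast_zero, completeInt_natCast, complete_zero]

theorem coeff_completeInt (a : ℤ) (m : ℕ →₀ ℕ) :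
    coeff m (completeInt a) = if (wt m : ℤ) = a then (zee m)⁻¹ else 0 := by
  rcases lt_or_ge a 0 with h | h
  · rw [completeInt_of_neg h, if_neg (by omega), coeff_zero]
  · obtain ⟨n, rfl⟩ := Int.eq_ofNat_of_zero_le h
    rw [completeInt_natCast, coeff_complete]
    simp only [Nat.cast_inj]

theorem pderiv_completeInt (a : ℤ) (r : ℕ) :
    ((r : ℝ) + 1) • pderiv r (completeInt a) = completeInt (a - (r + 1)) := by
  ext m
  rw [coeff_smul, coeff_pderiv, coeff_completeInt, coeff_completeInt, zee_add_single, map_add,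
    wt_single, smul_eq_mul]
  have h1 : ((r : ℝ) + 1) ≠ 0 := by positivity
  have h2 : ((m r : ℝ) + 1) ≠ 0 := by positivity
  have h3 := (zee_pos m).ne'
  by_cases h : (wt m : ℤ) = a - (r + 1)
  · rw [if_pos h, if_pos (by push_cast; omega)]
    field_simp
  · rw [if_neg h, if_neg (by push_cast; omega)]
    simp

/-- All terms of the recursion for the next coefficient are the same function, since ∂_r lowers the
index by r + 1; their number cancels the factor on the left. -/
theorem coeff_shift_completeInt (a : ℤ) (k : ℕ) :
    (shift (completeInt a)).coeff k = completeInt (a - k) := by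
  induction k using Nat.strong_induction_on generalizing a with
  | _ k ih =>
  rcases k with _ | k
  · rw [coeff_zero_shift]; simp
  · have hpos : ((k : ℝ) + 1) ≠ 0 := by positivity
    apply smul_right_injective SymFun hpos
    simp only
    rw [coeff_shift_succ]
    have h : ∀ r ∈ Finset.range (k + 1),
        (shift (((r : ℝ) + 1) • pderiv r (completeInt a))).coeff (k - r) =
          completeInt (a - (k + 1 : ℕ)) := by
      intro r hr
      have hr' := Finset.mem_range.1 hr
      rw [pderiv_completeInt, ih _ (by omega)]
      congr 1
      push_cast [Nat.cast_sub (Nat.lt_succ_iff.1 hr')]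
      ring
    rw [Finset.sum_congr rfl h, Finset.sum_const, Finset.card_range, ← Nat.cast_smul_eq_nsmul ℝ]
    push_cast
    rfl

theorem shift_completeInt_succ (a : ℤ) :
    shift (completeInt (a + 1)) =
      Polynomial.C (completeInt (a + 1)) + Polynomial.X * shift (completeInt a) := by
  ext1 k
  rcases k with _ | k
  · simp [coeff_zero_shift]
  · rw [Polynomial.coeff_add, Polynomial.coeff_X_mul, Polynomial.coeff_C_succ, zero_add,
      coeff_shift_completeInt, coeff_shift_completeInt]
    congr 1
    push_cast
    ring

/-- The Jacobi–Trudi determinant `det [h_{a_i - i + j}]` of a sequence. -/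
noncomputable def jacobiTrudi {m : ℕ} (a : Fin m → ℕ) : SymFun :=
  Matrix.det (Matrix.of fun i j : Fin m => completeInt ((a i : ℤ) - (i : ℤ) + (j : ℤ)))

/-- By `shift_completeInt_succ`, subtracting t times the previous column removes t from every column
but the first; then expand along that column. -/
theorem coeff_shift_jacobiTrudi {m : ℕ} (a : Fin (m + 1) → ℕ) (k : ℕ) :
    (shift (jacobiTrudi a)).coeff k = ∑ i : Fin (m + 1),
      (-1) ^ (i : ℕ) * completeInt ((a i : ℤ) - i - k) *
        Matrix.det (Matrix.of fun i' j : Fin m =>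
          completeInt ((a (i.succAbove i') : ℤ) - (i.succAbove i' : ℕ) + (j + 1))) := by
  have h := Matrix.det_eq_of_forall_col_eq_smul_add_pred
    (A := Matrix.of fun i j : Fin (m + 1) => shift (completeInt ((a i : ℤ) - (i : ℤ) + (j : ℤ))))
    (B := Matrix.of fun i j : Fin (m + 1) => Fin.cases (shift (completeInt ((a i : ℤ) - (i : ℤ))))
      (fun j' : Fin m =>
        Polynomial.C (completeInt ((a i : ℤ) - (i : ℤ) + (j' + 1)))) j)
    (fun _ => Polynomial.X) (by simp) (by
      intro i j
      simp only [Matrix.of_apply, Fin.cases_succ, Fin.val_succ, Fin.val_castSucc]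
      rw [show ((a i : ℤ) - i + ((j + 1 : ℕ) : ℤ)) = ((a i : ℤ) - i + j) + 1 by push_cast; ring,
        shift_completeInt_succ, add_assoc])
  have h2 : shift (jacobiTrudi a) = Matrix.det (Matrix.of fun i j : Fin (m + 1) =>
      shift (completeInt ((a i : ℤ) - (i : ℤ) + (j : ℤ)))) := by
    rw [jacobiTrudi, AlgHom.map_det]
    rfl
  rw [h2, h, Matrix.det_succ_column_zero, Polynomial.finsetSum_coeff]
  refine Finset.sum_congr rfl fun i _ => ?_
  have h3 : Matrix.det ((Matrix.of fun i j : Fin (m + 1) =>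
      Fin.cases (motive := fun _ => Polynomial SymFun) (shift (completeInt ((a i : ℤ) - (i : ℤ))))
      (fun j' : Fin m =>
        Polynomial.C (completeInt ((a i : ℤ) - (i : ℤ) + (j' + 1)))) j).submatrix
        i.succAbove Fin.succ) = Polynomial.C (Matrix.det (Matrix.of fun i' j : Fin m =>
          completeInt ((a (i.succAbove i') : ℤ) - (i.succAbove i' : ℕ) + (j + 1)))) := by
    rw [RingHom.map_det]
    rfl
  have h4 : ((-1 : Polynomial SymFun)) ^ (i : ℕ) = Polynomial.C ((-1) ^ (i : ℕ)) := by simp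
  rw [h3, Polynomial.coeff_mul_C, h4, Polynomial.coeff_C_mul]
  simp only [Matrix.of_apply, Fin.cases_zero]
  rw [coeff_shift_completeInt]

theorem coeff_shift_jacobiTrudi_of_lt {m : ℕ} {a : Fin (m + 1) → ℕ} (ha : Antitone a) {k : ℕ}
    (hk : a 0 < k) : (shift (jacobiTrudi a)).coeff k = 0 := by
  rw [coeff_shift_jacobiTrudi]
  refine Finset.sum_eq_zero fun i _ => ?_
  have := ha (Fin.zero_le i)
  rw [completeInt_of_neg (by omega)]
  simp

/-- For i > 0 the index a_i - i - a_0 is negative, so only the top row survives, with entry h_0 = 1.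
The adjoint of h_{a_0} thus strips the first row. -/
theorem coeff_shift_jacobiTrudi_self {m : ℕ} {a : Fin (m + 1) → ℕ} (ha : Antitone a) :
    (shift (jacobiTrudi a)).coeff (a 0) = jacobiTrudi (fun i : Fin m => a i.succ) := by
  rw [coeff_shift_jacobiTrudi, Finset.sum_eq_single 0]
  · simp only [Fin.val_zero, pow_zero, one_mul, Nat.cast_zero, sub_zero, sub_self,
      completeInt_zero, Fin.zero_succAbove, jacobiTrudi]
    congr 2
    ext1 i
    ext1 j
    congr 1
    simp only [Fin.val_succ]
    push_cast
    ring
  · intro i _ hi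
    have := ha (Fin.zero_le i)
    have hi' : 0 < (i : ℕ) := Nat.pos_of_ne_zero (fun h => hi (Fin.ext h))
    rw [completeInt_of_neg (by omega)]
    simp
  · simp

theorem toLex_lt_iff {m : ℕ} {a b : Fin m → ℕ} :
    toLex a < toLex b ↔ ∃ i, (∀ j < i, a j = b j) ∧ a i < b i := Iff.rfl

theorem pairing_prod_complete_self {m : ℕ} {a : Fin m → ℕ} (ha : Antitone a) :
    pairing (∏ i, complete (a i)) (jacobiTrudi a) = 1 := by
  induction m with
  | zero =>
    have : (1 : SymFun) = monomial 0 1 := rfl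
    simp only [Finset.univ_eq_empty, Finset.prod_empty, jacobiTrudi, Matrix.det_isEmpty]
    nth_rw 1 [this]
    rw [pairing_monomial, zee_zero, coeff_zero_one]
    norm_num
  | succ m ih =>
    rw [Fin.prod_univ_succ, pairing_complete_mul, coeff_shift_jacobiTrudi_self ha]
    exact ih fun i j h => ha (Fin.succ_le_succ_iff.2 h)

theorem pairing_prod_complete_of_lt {m : ℕ} {a b : Fin m → ℕ} (ha : Antitone a)
    (h : toLex a < toLex b) : pairing (∏ i, complete (b i)) (jacobiTrudi a) = 0 := by
  induction m with
  | zero =>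
    obtain ⟨i, _⟩ := toLex_lt_iff.1 h
    exact i.elim0
  | succ m ih =>
    obtain ⟨i, h1, h2⟩ := toLex_lt_iff.1 h
    rw [Fin.prod_univ_succ, pairing_complete_mul]
    rcases Fin.eq_zero_or_eq_succ i with rfl | ⟨i, rfl⟩
    · rw [coeff_shift_jacobiTrudi_of_lt ha h2, map_zero]
    · rw [← h1 0 (Fin.succ_pos i), coeff_shift_jacobiTrudi_self ha]
      refine ih (fun i j h => ha (Fin.succ_le_succ_iff.2 h))
        (toLex_lt_iff.2 ⟨i, fun j hj => h1 _ (Fin.succ_lt_succ_iff.2 hj), h2⟩)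

/-- Every term of a Jacobi–Trudi determinant but the diagonal one is a product of complete
symmetric functions with a lexicographically larger sequence of indices. -/
theorem prod_completeInt_eq {m : ℕ} (a : Fin m → ℕ) (w : Equiv.Perm (Fin m)) :
    (∏ i, completeInt ((a i : ℤ) - (i : ℤ) + (w i : ℤ))) = 0 ∨
    ∃ b : Fin m → ℕ, (∏ i, completeInt ((a i : ℤ) - (i : ℤ) + (w i : ℤ))) = ∏ i, complete (b i) ∧
      ∑ i, b i = ∑ i, a i ∧ (w ≠ 1 → toLex a < toLex b) := by
  by_cases h : ∀ i, 0 ≤ (a i : ℤ) - (i : ℤ) + (w i : ℤ)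
  · right
    refine ⟨fun i => ((a i : ℤ) - (i : ℤ) + (w i : ℤ)).toNat, ?_, ?_, ?_⟩
    · refine Finset.prod_congr rfl fun i _ => ?_
      rw [← completeInt_natCast, Int.toNat_of_nonneg (h i)]
    · zify
      rw [Finset.sum_congr rfl fun i _ => Int.toNat_of_nonneg (h i), Finset.sum_add_distrib,
        Finset.sum_sub_distrib, Equiv.sum_comp w fun i => (i : ℤ)]
      ring
    · intro hw
      have hex : (Finset.univ.filter fun i => w i ≠ i).Nonempty := by
        by_contra hne
        rw [Finset.not_nonempty_iff_eq_empty, Finset.filter_eq_empty_iff] at hne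
        exact hw (Equiv.ext fun i => not_not.1 (hne (Finset.mem_univ i)))
      -- The first point moved by w must move up, as all smaller values are already taken; there the
      -- index exceeds a i.
      obtain ⟨i, hi, hmin⟩ := Finset.exists_min_image _ id hex
      have hi' : w i ≠ i := (Finset.mem_filter.1 hi).2
      have hlow : ∀ j < i, w j = j := by
        intro j hj
        by_contra hne
        exact absurd (hmin j (Finset.mem_filter.2 ⟨Finset.mem_univ _, hne⟩)) (not_le.2 hj)
      refine toLex_lt_iff.2 ⟨i, fun j hj => ?_, ?_⟩
      · rw [hlow j hj]
        simp
      · have h2 : i < w i := by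
          refine lt_of_le_of_ne ?_ hi'.symm
          by_contra hlt
          exact hi' (w.injective (hlow _ (not_le.1 hlt)))
        have h3 : (i : ℕ) < w i := h2
        have h4 := h i
        omega
  · left
    push Not at h
    obtain ⟨i, hi⟩ := h
    exact Finset.prod_eq_zero (Finset.mem_univ i) (completeInt_of_neg hi)

theorem jacobiTrudi_eq_sum {m : ℕ} (a : Fin m → ℕ) : jacobiTrudi a =
    ∑ w : Equiv.Perm (Fin m), ((Equiv.Perm.sign w : ℤ) : ℝ) •
      ∏ i, completeInt ((a i : ℤ) - (i : ℤ) + (w i : ℤ)) := by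
  rw [jacobiTrudi, ← Matrix.det_transpose, Matrix.det_apply]
  refine Finset.sum_congr rfl fun w _ => ?_
  rw [Units.smul_def, ← Int.cast_smul_eq_zsmul ℝ]
  rfl

/-- A linear functional which vanishes on the products of complete symmetric functions whose
sequence of indices is lexicographically larger than `a`. -/
theorem apply_jacobiTrudi {m : ℕ} (a : Fin m → ℕ) (φ : SymFun →ₗ[ℝ] ℝ)
    (hφ : ∀ b : Fin m → ℕ, ∑ i, b i = ∑ i, a i → toLex a < toLex b →
      φ (∏ i, complete (b i)) = 0) :
    φ (jacobiTrudi a) = φ (∏ i, complete (a i)) := by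
  rw [jacobiTrudi_eq_sum, map_sum, Finset.sum_eq_single 1]
  · simp [completeInt_natCast]
  · intro w _ hw
    rw [map_smul]
    rcases prod_completeInt_eq a w with h | ⟨b, h1, h2, h3⟩
    · rw [h, map_zero, smul_zero]
    · rw [h1, hφ b h2 (h3 hw), smul_zero]
  · simp

/-- Expand the left factor in products of complete functions: by triangularity only the diagonal
product pairs nontrivially with the right one. -/
theorem pairing_jacobiTrudi_self {m : ℕ} {a : Fin m → ℕ} (ha : Antitone a) :
    pairing (jacobiTrudi a) (jacobiTrudi a) = 1 := by
  have h := apply_jacobiTrudi a (pairing.flip (jacobiTrudi a))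
    fun b _ hb => by
      rw [LinearMap.flip_apply]
      exact pairing_prod_complete_of_lt ha hb
  rw [LinearMap.flip_apply, LinearMap.flip_apply] at h
  rw [h, pairing_prod_complete_self ha]

theorem pairing_jacobiTrudi_of_ne {m : ℕ} {a b : Fin m → ℕ} (ha : Antitone a) (hb : Antitone b)
    (h : a ≠ b) : pairing (jacobiTrudi a) (jacobiTrudi b) = 0 := by
  -- The determinant of b expands into products indexed by sequences c ≥ b > a, each orthogonal to
  -- the determinant of a.
  have key : ∀ {a b : Fin m → ℕ}, Antitone a → toLex a < toLex b →
      pairing (jacobiTrudi b) (jacobiTrudi a) = 0 := by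
    intro a b ha hab
    have h := apply_jacobiTrudi b (pairing.flip (jacobiTrudi a))
      fun c _ hc => by
        rw [LinearMap.flip_apply]
        exact pairing_prod_complete_of_lt ha (hab.trans hc)
    rw [LinearMap.flip_apply, LinearMap.flip_apply] at h
    rw [h, pairing_prod_complete_of_lt ha hab]
  rcases lt_trichotomy (toLex a) (toLex b) with h1 | h1 | h1
  · rw [pairing_comm]
    exact key ha h1
  · exact absurd (toLex.injective h1) h
  · exact key hb h1

/-- The last row is (0, …, 0, h_0 = 1). Zero rows may therefore be appended, so that diagrams of
different lengths are compared at one common size. -/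
theorem jacobiTrudi_snoc_zero {m : ℕ} (a : Fin (m + 1) → ℕ) (h : a (Fin.last m) = 0) :
    jacobiTrudi a = jacobiTrudi fun i : Fin m => a i.castSucc := by
  rw [jacobiTrudi, Matrix.det_succ_row _ (Fin.last m), Finset.sum_eq_single (Fin.last m)]
  · rw [Matrix.of_apply, h]
    have h1 : ((-1 : SymFun)) ^ (((Fin.last m : Fin (m + 1)) : ℕ) + (Fin.last m : ℕ)) = 1 :=
      Even.neg_one_pow ⟨_, rfl⟩
    rw [h1]
    simp only [Nat.cast_zero, Fin.val_last, zero_sub, neg_add_cancel, completeInt_zero, one_mul,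
      Fin.succAbove_last, jacobiTrudi]
    rfl
  · intro j _ hj
    have : (j : ℕ) < m := Fin.val_lt_last hj
    rw [Matrix.of_apply, h, completeInt_of_neg (by simpa using this)]
    simp
  · simp

theorem schur_eq_jacobiTrudi (lam : YoungDiagram) (m : ℕ) (hm : lam.colLen 0 ≤ m) :
    schur lam = jacobiTrudi fun i : Fin m => lam.rowLen i := by
  induction m, hm using Nat.le_induction with
  | base => rfl
  | succ m hm ih =>
    rw [jacobiTrudi_snoc_zero _ ?_, ih]
    · rfl
    · by_contra hne
      have : (m, 0) ∈ lam := YoungDiagram.mem_iff_lt_rowLen.2 (Nat.pos_of_ne_zero hne)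
      have := YoungDiagram.mem_iff_lt_colLen.1 this
      omega

end SymFun

/-! ### Row lengths, and diagrams as exponents of power sum monomials. -/

namespace YoungDiagram

theorem colLen_zero_le_card (lam : YoungDiagram) : lam.colLen 0 ≤ lam.card := by
  rw [colLen_eq_card]
  exact Finset.card_le_card (Finset.filter_subset _ _)

theorem card_filter_fst_eq (lam : YoungDiagram) (i : ℕ) :
    (lam.cells.filter fun c => c.1 = i).card = lam.rowLen i :=
  lam.rowLen_eq_card.symm

theorem fst_lt_of_mem {lam : YoungDiagram} {n : ℕ} (hn : lam.colLen 0 ≤ n) {c : ℕ × ℕ}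
    (hc : c ∈ lam) : c.1 < n := by
  have h1 : (c.1, 0) ∈ lam := lam.up_left_mem le_rfl (Nat.zero_le _) hc
  exact (mem_iff_lt_colLen.1 h1).trans_le hn

theorem sum_rowLen (lam : YoungDiagram) {n : ℕ} (hn : lam.colLen 0 ≤ n) :
    ∑ i : Fin n, lam.rowLen i = lam.card := by
  rw [Fin.sum_univ_eq_sum_range (fun i => lam.rowLen i), YoungDiagram.card,
    Finset.card_eq_sum_card_fiberwise (f := Prod.fst) (t := Finset.range n)]
  · exact Finset.sum_congr rfl fun i _ => (lam.card_filter_fst_eq i).symm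
  · intro c hc
    exact Finset.mem_coe.2 (Finset.mem_range.2 (fst_lt_of_mem hn hc))

theorem rowLen_injective : Function.Injective rowLen := by
  intro a b h
  ext ⟨i, j⟩
  rw [mem_cells, mem_cells, mem_iff_lt_rowLen, mem_iff_lt_rowLen, h]

theorem rowLen_eq_zero {lam : YoungDiagram} {i : ℕ} (h : lam.colLen 0 ≤ i) : lam.rowLen i = 0 := by
  by_contra hne
  have h1 : (i, 0) ∈ lam := mem_iff_lt_rowLen.2 (Nat.pos_of_ne_zero hne)
  have := mem_iff_lt_colLen.1 h1
  omega

theorem sum_rowLens (lam : YoungDiagram) : lam.rowLens.sum = lam.card := by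
  rw [rowLens, ← lam.sum_rowLen le_rfl, Fin.sum_univ_eq_sum_range (fun i => lam.rowLen i)]
  rfl

/-- The exponent of `∏ p_{lam_i}`. -/
noncomputable def rowExp (lam : YoungDiagram) : ℕ →₀ ℕ :=
  Multiset.toFinsupp ((lam.rowLens : Multiset ℕ).map Nat.pred)

/-- A diagram is the sorted list of its positive row lengths. Only the resulting equality of numbers
of diagrams and monomials in each degree is needed later. -/
theorem rowExp_bijective : Function.Bijective rowExp := by
  constructor
  · intro a b h
    have h1 := Multiset.toFinsupp.injective h
    have h2 : ∀ c : YoungDiagram,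
        (((c.rowLens : Multiset ℕ).map Nat.pred).map Nat.succ) = c.rowLens := by
      intro c
      rw [Multiset.map_map]
      refine (Multiset.map_congr rfl fun x hx => ?_).trans (Multiset.map_id _)
      exact Nat.succ_pred_eq_of_pos (c.pos_of_mem_rowLens x hx)
    have h3 : (a.rowLens : Multiset ℕ) = b.rowLens := by rw [← h2 a, ← h2 b, h1]
    have h4 : a.rowLens = b.rowLens :=
      (Multiset.coe_eq_coe.1 h3).eq_of_sortedGE a.rowLens_sorted b.rowLens_sorted
    exact equivListRowLens.injective (Subtype.ext h4)
  · intro m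
    set w := ((Finsupp.toMultiset m).map Nat.succ).sort (· ≥ ·) with hw
    have hs : w.SortedGE := (Multiset.pairwise_sort _ _).sortedGE
    have hpos : ∀ x ∈ w, 0 < x := by
      intro x hx
      rw [hw, Multiset.mem_sort, Multiset.mem_map] at hx
      obtain ⟨y, _, rfl⟩ := hx
      exact Nat.succ_pos y
    refine ⟨ofRowLens w hs, ?_⟩
    rw [rowExp, rowLens_ofRowLens_eq_self hpos, hw, Multiset.sort_eq, Multiset.map_map]
    have : (Nat.pred ∘ Nat.succ) = id := rfl
    rw [this, Multiset.map_id, Finsupp.toMultiset_toFinsupp]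

end YoungDiagram

/-! ### Schur functions: orthonormality, completeness and the diagonal bound. -/

namespace SymFun

open MvPolynomial

theorem wt_toFinsupp (s : Multiset ℕ) :
    wt (Multiset.toFinsupp s) = (s.map Nat.succ).sum := by
  induction s using Multiset.induction_on with
  | empty => simp
  | cons a s ih =>
    rw [← Multiset.singleton_add, map_add, map_add, ih, Multiset.toFinsupp_singleton, wt_single]
    simp

theorem wt_rowExp (lam : YoungDiagram) : wt lam.rowExp = lam.card := by
  rw [YoungDiagram.rowExp, wt_toFinsupp, Multiset.map_map, ← lam.sum_rowLens,
    ← Multiset.sum_coe]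
  congr 1
  refine (Multiset.map_congr rfl fun x hx => ?_).trans (Multiset.map_id _)
  exact Nat.succ_pred_eq_of_pos (lam.pos_of_mem_rowLens x hx)

theorem isWeightedHomogeneous_jacobiTrudi {m : ℕ} (a : Fin m → ℕ) :
    IsWeightedHomogeneous (fun k : ℕ => k + 1) (jacobiTrudi a) (∑ i, a i) := by
  rw [jacobiTrudi_eq_sum]
  refine IsWeightedHomogeneous.sum _ _ _ fun w _ => ?_
  have hc : ∀ n, IsWeightedHomogeneous (fun k : ℕ => k + 1) (complete n) n := by
    intro n d hd
    rw [coeff_complete] at hd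
    by_contra h
    exact hd (if_neg h)
  have h : IsWeightedHomogeneous (fun k : ℕ => k + 1)
      (∏ i, completeInt ((a i : ℤ) - (i : ℤ) + (w i : ℤ))) (∑ i, a i) := by
    rcases prod_completeInt_eq a w with h | ⟨b, h1, h2, -⟩
    · rw [h]
      exact isWeightedHomogeneous_zero _ _ _
    · rw [h1, ← h2]
      exact IsWeightedHomogeneous.prod _ _ _ fun i _ => hc _
  intro d hd
  rw [coeff_smul] at hd
  exact h (right_ne_zero_of_mul hd)

theorem schur_eq_jacobiTrudi_card {lam : YoungDiagram} {N : ℕ} (h : lam.card = N) :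
    schur lam = jacobiTrudi fun i : Fin N => lam.rowLen i :=
  schur_eq_jacobiTrudi lam N (h ▸ lam.colLen_zero_le_card)

theorem wt_eq_card_of_coeff_schur_ne_zero {lam : YoungDiagram} {m : ℕ →₀ ℕ}
    (h : coeff m (schur lam) ≠ 0) : wt m = lam.card := by
  rw [schur_eq_jacobiTrudi_card rfl] at h
  rw [← lam.sum_rowLen lam.colLen_zero_le_card]
  exact isWeightedHomogeneous_jacobiTrudi _ h

theorem rowLen_antitone (lam : YoungDiagram) (N : ℕ) :
    Antitone fun i : Fin N => lam.rowLen i :=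
  fun i j h => lam.rowLen_anti i j h

theorem pairing_schur_self (lam : YoungDiagram) : pairing (schur lam) (schur lam) = 1 := by
  rw [schur_eq_jacobiTrudi_card rfl]
  exact pairing_jacobiTrudi_self (rowLen_antitone lam _)

theorem rowLen_fin_ne {lam mu : YoungDiagram} {N : ℕ} (h1 : lam.card = N) (h2 : mu.card = N)
    (h : lam ≠ mu) : (fun i : Fin N => lam.rowLen i) ≠ fun i : Fin N => mu.rowLen i := by
  intro he
  apply h
  apply YoungDiagram.rowLen_injective
  funext i
  by_cases hi : i < N
  · exact congrFun he ⟨i, hi⟩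
  · rw [YoungDiagram.rowLen_eq_zero (lam.colLen_zero_le_card.trans (by omega)),
      YoungDiagram.rowLen_eq_zero (mu.colLen_zero_le_card.trans (by omega))]

theorem pairing_schur_of_ne {lam mu : YoungDiagram} (h1 : lam.card = mu.card) (h : lam ≠ mu) :
    pairing (schur lam) (schur mu) = 0 := by
  rw [schur_eq_jacobiTrudi_card h1, schur_eq_jacobiTrudi_card rfl]
  exact pairing_jacobiTrudi_of_ne (rowLen_antitone _ _) (rowLen_antitone _ _)
    (rowLen_fin_ne h1 rfl h)

/-- Diagrams with `N` boxes correspond to monomials of degree `N`. -/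
noncomputable def levelEquiv (N : ℕ) : ↥(YoungGraph.level N) ≃ {m : ℕ →₀ ℕ // wt m = N} :=
  (Equiv.ofBijective _ YoungDiagram.rowExp_bijective).subtypeEquiv fun lam => by
    rw [YoungGraph.mem_level, Equiv.ofBijective_apply, wt_rowExp]

/-- Orthonormality reads AB = 1 for the matrix A of power sum coefficients and its z-weighted
transpose B. The index sets are equinumerous by `levelEquiv`, so BA = 1, which is completeness. -/
theorem monomial_eq_sum_schur {N : ℕ} {m : ℕ →₀ ℕ} (hm : wt m = N) :
    monomial m (1 : ℝ) =
      ∑ lam ∈ YoungGraph.level N, pairing (schur lam) (monomial m 1) • schur lam := by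
  classical
  let _ : Fintype {m : ℕ →₀ ℕ // wt m = N} := Fintype.ofEquiv _ (levelEquiv N)
  let A : Matrix ↥(YoungGraph.level N) {m : ℕ →₀ ℕ // wt m = N} ℝ :=
    Matrix.of fun lam m => coeff m.1 (schur lam.1)
  let B : Matrix {m : ℕ →₀ ℕ // wt m = N} ↥(YoungGraph.level N) ℝ :=
    Matrix.of fun m lam => zee m.1 * coeff m.1 (schur lam.1)
  have hAB : A * B = 1 := by
    ext lam mu
    have h1 : lam.1.card = N := YoungGraph.mem_level.1 lam.2
    have h2 : mu.1.card = N := YoungGraph.mem_level.1 mu.2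
    have h3 : pairing (schur lam.1) (schur mu.1) = (A * B) lam mu := by
      rw [pairing_eq_sum, Matrix.mul_apply]
      have hs : (schur lam.1).support ⊆
          Finset.univ.map (Function.Embedding.subtype fun m : ℕ →₀ ℕ => wt m = N) := by
        intro d hd
        rw [Finset.mem_map]
        exact ⟨⟨d, (wt_eq_card_of_coeff_schur_ne_zero (mem_support_iff.1 hd)).trans h1⟩,
          Finset.mem_univ _, rfl⟩
      rw [Finset.sum_subset hs, Finset.sum_map]
      · refine Finset.sum_congr rfl fun d _ => ?_
        simp only [A, B, Matrix.of_apply, Function.Embedding.subtype_apply]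
        ring
      · intro d _ hd
        rw [notMem_support_iff.1 hd]
        simp
    rw [← h3]
    by_cases h : lam = mu
    · rw [h, pairing_schur_self, Matrix.one_apply_eq]
    · rw [Matrix.one_apply_ne h, pairing_schur_of_ne (h1.trans h2.symm)
        fun he => h (Subtype.ext he)]
  have hBA : B * A = 1 := (Matrix.mul_eq_one_comm_of_equiv (levelEquiv N)).1 hAB
  have hp : ∀ lam, pairing (schur lam) (monomial m 1) = zee m * coeff m (schur lam) := by
    intro lam
    rw [pairing_comm, pairing_monomial, one_mul]
  ext d
  rw [coeff_sum]
  simp only [coeff_smul, hp, smul_eq_mul]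
  by_cases hd : wt d = N
  · have h := congrFun (congrFun hBA ⟨m, hm⟩) ⟨d, hd⟩
    rw [Matrix.mul_apply, Matrix.one_apply] at h
    rw [coeff_monomial, ← Finset.sum_coe_sort]
    simp only [A, B, Matrix.of_apply, Subtype.mk.injEq] at h
    exact h.symm
  · rw [coeff_monomial, if_neg (fun he : m = d => hd (he ▸ hm)), Finset.sum_eq_zero]
    intro lam hlam
    have : coeff d (schur lam) = 0 := by
      by_contra hne
      exact hd ((wt_eq_card_of_coeff_schur_ne_zero hne).trans (YoungGraph.mem_level.1 hlam))
    rw [this, mul_zero]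

theorem completeInt_mem_idealOfVars {a : ℤ} (ha : 0 < a) :
    completeInt a ∈ idealOfVars ℕ ℝ := by
  rw [← pow_one (idealOfVars ℕ ℝ), mem_pow_idealOfVars_iff']
  intro m hm
  have hm0 : m = 0 := (Finsupp.degree_eq_zero_iff m).1 (by omega)
  rw [coeff_completeInt, hm0, if_neg (by simp; omega)]

/-- In a row with i < a_i every index a_i - i + j is positive, and h_k with k > 0 has no constant
term; each term of the determinant takes one entry from each such row. -/
theorem jacobiTrudi_mem_pow_idealOfVars {m : ℕ} (a : Fin m → ℕ) :
    jacobiTrudi a ∈ idealOfVars ℕ ℝ ^ (Finset.univ.filter fun i : Fin m => (i : ℕ) < a i).card := by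
  rw [jacobiTrudi_eq_sum]
  refine Ideal.sum_mem _ fun w _ => ?_
  rw [smul_eq_C_mul]
  refine Ideal.mul_mem_left _ _ ?_
  rw [← Finset.prod_filter_mul_prod_filter_not Finset.univ fun i : Fin m => (i : ℕ) < a i]
  refine Ideal.mul_mem_right _ _ ?_
  rw [← Finset.prod_const]
  refine Ideal.prod_mem_prod fun i hi => completeInt_mem_idealOfVars ?_
  have := (Finset.mem_filter.1 hi).2
  omega

theorem diagLen_eq {lam : YoungDiagram} {N : ℕ} (hN : lam.card = N) : YoungGraph.diagLen lam =
    (Finset.univ.filter fun i : Fin N => (i : ℕ) < lam.rowLen i).card := by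
  rw [YoungGraph.diagLen]
  refine Finset.card_bij' (fun c hc => ⟨c.1, YoungDiagram.fst_lt_of_mem
    (hN ▸ lam.colLen_zero_le_card) (Finset.mem_filter.1 hc).1⟩) (fun i _ => (i.1, i.1)) ?_ ?_ ?_ ?_
  · rintro ⟨i, j⟩ hc
    obtain ⟨h1, h2⟩ := Finset.mem_filter.1 hc
    simp only at h2
    subst h2
    exact Finset.mem_filter.2 ⟨Finset.mem_univ _, YoungDiagram.mem_iff_lt_rowLen.1 h1⟩
  · intro i hi
    exact Finset.mem_filter.2 ⟨YoungDiagram.mem_iff_lt_rowLen.2 (Finset.mem_filter.1 hi).2, rfl⟩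
  · rintro ⟨i, j⟩ hc
    obtain ⟨h1, h2⟩ := Finset.mem_filter.1 hc
    simp only at h2
    subst h2
    rfl
  · intro i _
    rfl

/-- Every monomial `p_{r_1} ⋯ p_{r_n}` in `s_lam` has at least `d(lam)` factors. -/
theorem pairing_schur_monomial_of_degree_lt {lam : YoungDiagram} {m : ℕ →₀ ℕ}
    (h : m.degree < YoungGraph.diagLen lam) : pairing (schur lam) (monomial m 1) = 0 := by
  have h1 := jacobiTrudi_mem_pow_idealOfVars fun i : Fin lam.card => lam.rowLen i
  rw [← diagLen_eq rfl, ← schur_eq_jacobiTrudi_card rfl, mem_pow_idealOfVars_iff'] at h1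
  rw [pairing_comm, pairing_monomial, h1 m h]
  simp

end SymFun

/-! ### Cycle types and the characteristic map -/

namespace Equiv.Perm

variable {X : Type*} [Fintype X] [DecidableEq X]

/-- The exponent `m` of the power sum monomial `p^m` given by the cycles of a permutation. -/
noncomputable def cycleExp (g : Perm X) : ℕ →₀ ℕ :=
  Multiset.toFinsupp (g.cycleType.map Nat.pred) +
    Finsupp.single 0 (Fintype.card X - g.cycleType.sum)

theorem map_succ_map_pred_cycleType (g : Perm X) :
    (g.cycleType.map Nat.pred).map Nat.succ = g.cycleType := by
  rw [Multiset.map_map]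
  refine (Multiset.map_congr rfl fun x hx => ?_).trans (Multiset.map_id _)
  exact Nat.succ_pred_eq_of_pos (zero_lt_one.trans (one_lt_of_mem_cycleType hx))

theorem toFinsupp_parts_partition (g : Perm X) :
    Multiset.toFinsupp (g.partition.parts.map Nat.pred) = g.cycleExp := by
  rw [parts_partition, Multiset.map_add, map_add, cycleExp, sum_cycleType, Multiset.map_replicate,
    ← Multiset.nsmul_singleton, map_nsmul, Multiset.toFinsupp_singleton, Finsupp.smul_single]
  simp

theorem erase_cycleExp (g : Perm X) :
    g.cycleExp.erase 0 = Multiset.toFinsupp (g.cycleType.map Nat.pred) := by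
  ext k
  rw [Finsupp.erase_apply]
  split_ifs with hk
  · subst hk
    rw [Multiset.toFinsupp_apply, eq_comm, Multiset.count_eq_zero, Multiset.mem_map]
    rintro ⟨x, hx, h0⟩
    have := one_lt_of_mem_cycleType hx
    have : x - 1 = 0 := h0
    omega
  · rw [cycleExp, Finsupp.add_apply, Finsupp.single_apply, if_neg (Ne.symm hk), add_zero]

theorem wt_cycleExp (g : Perm X) : SymFun.wt g.cycleExp = Fintype.card X := by
  have h : SymFun.wt (Multiset.toFinsupp (g.cycleType.map Nat.pred)) = g.cycleType.sum := by
    rw [SymFun.wt_toFinsupp, map_succ_map_pred_cycleType]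
  rw [cycleExp, map_add, h, SymFun.wt_single]
  have := g.sum_cycleType_le
  omega

theorem isConj_of_cycleExp_eq {g h : Perm X} (e : g.cycleExp = h.cycleExp) : IsConj g h := by
  rw [isConj_iff_cycleType_eq, ← map_succ_map_pred_cycleType g, ← map_succ_map_pred_cycleType h]
  have h1 := congrArg (Finsupp.erase 0) e
  rw [erase_cycleExp, erase_cycleExp] at h1
  rw [Multiset.toFinsupp.injective h1]

/-- The weight condition fixes the number of fixed points, which `cycleType` omits, once the longer
cycles agree. -/
theorem cycleExp_eq_iff {m : ℕ →₀ ℕ} (hm : SymFun.wt m = Fintype.card X) (g : Perm X) :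
    g.cycleExp = m ↔
      g.cycleType = (Finsupp.toMultiset (m.erase 0)).map Nat.succ := by
  constructor
  · rintro rfl
    rw [erase_cycleExp, Multiset.toFinsupp_toMultiset, map_succ_map_pred_cycleType]
  · intro h
    have h1 : Multiset.toFinsupp (g.cycleType.map Nat.pred) = m.erase 0 := by
      rw [h, Multiset.map_map]
      have : (Nat.pred ∘ Nat.succ) = id := rfl
      rw [this, Multiset.map_id, Finsupp.toMultiset_toFinsupp]
    have h2 := g.wt_cycleExp
    rw [cycleExp, h1, map_add, SymFun.wt_single] at h2
    have h3 : SymFun.wt m = SymFun.wt (m.erase 0) + m 0 := by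
      conv_lhs => rw [← Finsupp.erase_add_single 0 m]
      rw [map_add, SymFun.wt_single]
      simp
    rw [cycleExp, h1]
    conv_rhs => rw [← Finsupp.erase_add_single 0 m]
    congr 2
    omega

theorem card_cycleExp_mul_zee {m : ℕ →₀ ℕ} (hm : SymFun.wt m = Fintype.card X) :
    ((Finset.univ.filter fun g : Perm X => g.cycleExp = m).card : ℝ) * SymFun.zee m =
      (Fintype.card X).factorial := by
  set m' := Finsupp.mapDomain Nat.succ (m.erase 0) with hm'
  have hc : (Finsupp.toMultiset (m.erase 0)).map Nat.succ = Finsupp.toMultiset m' :=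
    Finsupp.toMultiset_map _ _
  have h1 : (Finset.univ.filter fun g : Perm X => g.cycleExp = m) =
      Finset.univ.filter fun g : Perm X => g.cycleType = Finsupp.toMultiset m' := by
    refine Finset.filter_congr fun g _ => ?_
    rw [cycleExp_eq_iff hm, hc]
  have h3 : SymFun.wt m = SymFun.wt (m.erase 0) + m 0 := by
    conv_lhs => rw [← Finsupp.erase_add_single 0 m]
    rw [map_add, SymFun.wt_single]
    simp
  have hsum : (Finsupp.toMultiset m').sum = SymFun.wt (m.erase 0) := by
    rw [← hc, ← SymFun.wt_toFinsupp, Finsupp.toMultiset_toFinsupp]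
  have hprod : (Finsupp.toMultiset m').prod = (m.erase 0).prod fun k a => (k + 1) ^ a := by
    rw [Finsupp.prod_toMultiset, hm', Finsupp.prod_mapDomain_index_inj Nat.succ_injective]
  have hcount : (∏ n ∈ (Finsupp.toMultiset m').toFinset,
      ((Finsupp.toMultiset m').count n).factorial) =
      (m.erase 0).prod fun _ a => a.factorial := by
    rw [Finsupp.toFinset_toMultiset]
    simp only [Finsupp.count_toMultiset]
    change m'.prod (fun _ a => a.factorial) = _
    rw [hm', Finsupp.prod_mapDomain_index_inj Nat.succ_injective]
  have hcond : (Finsupp.toMultiset m').sum ≤ Fintype.card X ∧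
      ∀ a ∈ Finsupp.toMultiset m', 2 ≤ a := by
    refine ⟨by omega, fun a ha => ?_⟩
    rw [← hc, Multiset.mem_map] at ha
    obtain ⟨k, hk, rfl⟩ := ha
    rw [Finsupp.mem_toMultiset, Finsupp.support_erase, Finset.mem_erase] at hk
    have := hk.1
    omega
  have h := card_of_cycleType_mul_eq X (Finsupp.toMultiset m')
  rw [if_pos hcond, hsum, hprod, hcount] at h
  -- The factor of z_m at k = 0 is 1^{m_0} m_0!, where m_0 counts the fixed points.
  have hz : SymFun.zee m = (((Fintype.card X - SymFun.wt (m.erase 0)).factorial *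
      ((m.erase 0).prod fun k a => (k + 1) ^ a) * (m.erase 0).prod fun _ a => a.factorial : ℕ) :
        ℝ) := by
    have h4 : Fintype.card X - SymFun.wt (m.erase 0) = m 0 := by omega
    rw [h4, SymFun.zee, ← Finsupp.mul_prod_erase' m 0 _ (by simp), Finsupp.prod,
      Finsupp.prod, Finsupp.prod, Finset.prod_mul_distrib]
    push_cast
    simp only [zero_add, one_pow, one_mul, mul_assoc]
  rw [h1, hz, ← h]
  push_cast
  ring

end Equiv.Perm

/-! ### The Frobenius characteristic map. -/

namespace SymFun

open MvPolynomial Equiv.Perm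

/-- The power sum monomial of a permutation. -/
noncomputable def cycleMonomial {X : Type*} [Fintype X] [DecidableEq X] (g : Equiv.Perm X) :
    SymFun :=
  monomial g.cycleExp 1

variable {X : Type*} [Fintype X] [DecidableEq X]

/-- The class of type m has N!/z_m elements, where N is the number of points, and 1/z_m is the
coefficient of p^m in h_N. -/
theorem sum_cycleMonomial :
    ∑ g : Equiv.Perm X, cycleMonomial g =
      ((Fintype.card X).factorial : ℝ) • complete (Fintype.card X) := by
  ext m
  rw [coeff_sum, coeff_smul, coeff_complete]
  simp only [cycleMonomial, coeff_monomial]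
  rw [← Finset.sum_filter, Finset.sum_const, nsmul_eq_mul, mul_one]
  split_ifs with h
  · rw [← card_cycleExp_mul_zee h, smul_eq_mul, mul_assoc,
      mul_inv_cancel₀ (zee_pos m).ne', mul_one]
  · rw [smul_zero, Nat.cast_eq_zero, Finset.card_eq_zero, Finset.filter_eq_empty_iff]
    rintro g - rfl
    exact h g.wt_cycleExp

/-- The characteristic map from class functions to symmetric functions. -/
noncomputable def charMap (χ : Equiv.Perm X → ℝ) : SymFun :=
  ((Fintype.card X).factorial : ℝ)⁻¹ • ∑ g, χ g • cycleMonomial g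

theorem pairing_charMap (χ : Equiv.Perm X → ℝ) (f : SymFun) : pairing (charMap χ) f =
    ((Fintype.card X).factorial : ℝ)⁻¹ * ∑ g, χ g * pairing (cycleMonomial g) f := by
  rw [charMap, map_smul, LinearMap.smul_apply, map_sum, LinearMap.sum_apply, smul_eq_mul]
  simp only [map_smul, LinearMap.smul_apply, smul_eq_mul]

/-- Only the conjugacy class of g contributes, and its size times the norm z of the monomial cancels
the factorial. -/
theorem pairing_charMap_cycleMonomial {χ : Equiv.Perm X → ℝ}
    (hχ : ∀ g h, IsConj g h → χ g = χ h) (g : Equiv.Perm X) :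
    pairing (charMap χ) (cycleMonomial g) = χ g := by
  rw [pairing_charMap]
  have h1 : ∀ h : Equiv.Perm X, χ h * pairing (cycleMonomial h) (cycleMonomial g) =
      if h.cycleExp = g.cycleExp then χ g * zee g.cycleExp else 0 := by
    intro h
    rw [cycleMonomial, cycleMonomial, pairing_monomial, coeff_monomial]
    by_cases e : h.cycleExp = g.cycleExp
    · rw [if_pos e, if_pos e.symm, hχ h g (isConj_of_cycleExp_eq e), e]
      ring
    · rw [if_neg e, if_neg (Ne.symm e)]
      ring
  rw [Finset.sum_congr rfl fun h _ => h1 h, ← Finset.sum_filter, Finset.sum_const, nsmul_eq_mul,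
    mul_left_comm (_ : ℝ) (χ g), card_cycleExp_mul_zee g.wt_cycleExp, mul_left_comm,
    inv_mul_cancel₀ (by positivity), mul_one]

theorem pairing_charMap_self {χ : Equiv.Perm X → ℝ}
    (hχ : ∀ g h, IsConj g h → χ g = χ h) :
    pairing (charMap χ) (charMap χ) =
      ((Fintype.card X).factorial : ℝ)⁻¹ * ∑ g, χ g * χ g := by
  rw [pairing_charMap]
  congr 1
  refine Finset.sum_congr rfl fun g _ => ?_
  rw [pairing_comm, pairing_charMap_cycleMonomial hχ]

end SymFun

/-! ### Young subgroups: permutations preserving the fibers of a map. -/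

namespace Equiv.Perm

section

variable {X ι : Type*} [DecidableEq ι] (f : X → ι)

theorem ofSubtype_fiber_disjoint (F : ∀ i, Perm {x // f x = i}) {i j : ι} (h : i ≠ j) :
    Disjoint (ofSubtype (F i)) (ofSubtype (F j)) := by
  intro x
  by_cases hx : f x = i
  · right
    exact ofSubtype_apply_of_not_mem _ fun hj => h (hx.symm.trans hj)
  · left
    exact ofSubtype_apply_of_not_mem _ hx

theorem pairwise_commute_ofSubtype_fiber (F : ∀ i, Perm {x // f x = i}) (s : Set ι) :
    s.Pairwise (Function.onFun Commute fun i => ofSubtype (F i)) :=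
  fun _ _ _ _ h => (ofSubtype_fiber_disjoint f F h).commute

variable [Fintype ι]

/-- The permutation which preserves the fibers of `f` and acts on them in the given way. -/
noncomputable def ofFibers (F : ∀ i, Perm {x // f x = i}) : Perm X :=
  Finset.univ.noncommProd (fun i => ofSubtype (F i))
    (pairwise_commute_ofSubtype_fiber f F _)

theorem ofFibers_apply (F : ∀ i, Perm {x // f x = i}) (x : X) :
    ofFibers f F x = F (f x) ⟨x, rfl⟩ := by
  have key : ∀ s : Finset ι, s.noncommProd (fun i => ofSubtype (F i))
      (pairwise_commute_ofSubtype_fiber f F _) x =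
        if f x ∈ s then (F (f x) ⟨x, rfl⟩ : X) else x := by
    intro s
    induction s using Finset.induction_on with
    | empty => simp
    | insert i s hi ih =>
      rw [Finset.noncommProd_insert_of_notMem _ _ _ _ hi, mul_apply, ih]
      by_cases hxi : f x = i
      · subst hxi
        rw [if_neg hi, if_pos (Finset.mem_insert_self _ _)]
        exact ofSubtype_apply_of_mem (F (f x)) rfl
      · by_cases hs : f x ∈ s
        · rw [if_pos hs, if_pos (Finset.mem_insert_of_mem hs), ofSubtype_apply_of_not_mem]
          rw [(F (f x) ⟨x, rfl⟩).2]
          exact hxi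
        · rw [if_neg hs, if_neg (by simp [hxi, hs])]
          exact ofSubtype_apply_of_not_mem (F i) hxi
  rw [ofFibers, key, if_pos (Finset.mem_univ _)]

end

variable {X ι : Type*} [Fintype X] [DecidableEq X] [Fintype ι] [DecidableEq ι] (f : X → ι)

theorem cycleExp_ofFibers (F : ∀ i, Perm {x // f x = i}) :
    (ofFibers f F).cycleExp = ∑ i, (F i).cycleExp := by
  have h1 : (ofFibers f F).cycleType = ∑ i, (F i).cycleType := by
    rw [ofFibers, Disjoint.cycleType_noncommProd fun _ _ _ _ h => ofSubtype_fiber_disjoint f F h]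
    simp only [cycleType_ofSubtype]
  have h2 : Fintype.card X = ∑ i, Fintype.card {x // f x = i} := by
    rw [← Fintype.card_sigma]
    exact Fintype.card_congr (Equiv.sigmaFiberEquiv f).symm
  simp only [cycleExp]
  rw [Finset.sum_add_distrib, h1, h2]
  congr 1
  · rw [← Multiset.coe_mapAddMonoidHom, map_sum, map_sum]
  · rw [← Finsupp.single_finsetSum, ← Multiset.coe_sumAddMonoidHom, map_sum,
      Finset.sum_tsub_distrib]
    intro i _
    exact (F i).sum_cycleType_le

/-- A Young subgroup is the product of the symmetric groups of the fibers. -/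
theorem sum_filter_preserving {M : Type*} [AddCommMonoid M] (φ : Perm X → M) :
    ∑ g ∈ Finset.univ.filter (fun g : Perm X => ∀ x, f (g x) = f x), φ g =
      ∑ F : ∀ i, Perm {x // f x = i}, φ (ofFibers f F) := by
  symm
  refine Finset.sum_bij (fun F _ => ofFibers f F) ?_ ?_ ?_ fun _ _ => rfl
  · intro F _
    refine Finset.mem_filter.2 ⟨Finset.mem_univ _, fun x => ?_⟩
    rw [ofFibers_apply]
    exact (F (f x) ⟨x, rfl⟩).2
  · intro F _ G _ h
    funext i
    ext ⟨x, hx⟩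
    subst hx
    have := congrArg (fun g : Perm X => g x) h
    simpa only [ofFibers_apply] using this
  · intro g hg
    have hg' := (Finset.mem_filter.1 hg).2
    refine ⟨fun i => g.subtypePerm fun x => by rw [hg'], Finset.mem_univ _, ?_⟩
    ext x
    rw [ofFibers_apply]
    rfl

theorem card_filter_preserving :
    (Finset.univ.filter (fun g : Perm X => ∀ x, f (g x) = f x)).card =
      ∏ i, (Fintype.card {x // f x = i}).factorial := by
  rw [Finset.card_eq_sum_ones, sum_filter_preserving, Finset.sum_const, smul_eq_mul, mul_one,
    Finset.card_univ, Fintype.card_pi]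
  exact Finset.prod_congr rfl fun i _ => Fintype.card_perm

end Equiv.Perm

namespace SymFun

open MvPolynomial Equiv.Perm

variable {X ι : Type*} [Fintype X] [DecidableEq X] [Fintype ι] [DecidableEq ι]

/-- The cycle monomial is multiplicative over fibers, so the sum factors into full symmetric group
sums. -/
theorem sum_cycleMonomial_filter (f : X → ι) :
    ∑ g ∈ Finset.univ.filter (fun g : Equiv.Perm X => ∀ x, f (g x) = f x), cycleMonomial g =
      (∏ i, ((Fintype.card {x // f x = i}).factorial : ℝ)) •
        ∏ i, complete (Fintype.card {x // f x = i}) := by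
  have h1 : ∀ F : ∀ i, Equiv.Perm {x // f x = i},
      cycleMonomial (ofFibers f F) = ∏ i, cycleMonomial (F i) := by
    intro F
    simp only [cycleMonomial]
    rw [cycleExp_ofFibers, ← monomial_sum_one]
  rw [sum_filter_preserving, Finset.sum_congr rfl fun F _ => h1 F]
  rw [← Fintype.piFinset_univ, ← Finset.prod_univ_sum]
  simp only [sum_cycleMonomial, smul_eq_C_mul]
  rw [Finset.prod_mul_distrib, map_prod]

/-- Frobenius reciprocity: pairing with a product of complete functions averages χ over the
corresponding Young subgroup. -/
theorem pairing_charMap_prod_complete {χ : Equiv.Perm X → ℝ}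
    (hχ : ∀ g h, IsConj g h → χ g = χ h) (f : X → ι) :
    (∏ i, ((Fintype.card {x // f x = i}).factorial : ℝ)) *
      pairing (charMap χ) (∏ i, complete (Fintype.card {x // f x = i})) =
    ∑ g ∈ Finset.univ.filter (fun g : Equiv.Perm X => ∀ x, f (g x) = f x), χ g := by
  rw [← smul_eq_mul, ← map_smul, ← sum_cycleMonomial_filter, map_sum]
  exact Finset.sum_congr rfl fun g _ => pairing_charMap_cycleMonomial hχ g

end SymFun

/-! ### Young symmetrizers -/

namespace YoungDiagram

theorem card_filter_snd_lt (lam : YoungDiagram) (i j : ℕ) :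
    (Finset.univ.filter fun x : lam.cells => x.1.2 = j ∧ x.1.1 < i).card =
      min i (lam.colLen j) := by
  have h : (Finset.univ.filter fun x : lam.cells => x.1.2 = j ∧ x.1.1 < i).card =
      (Finset.range (min i (lam.colLen j))).card := by
    refine Finset.card_bij (fun x _ => x.1.1) ?_ ?_ ?_
    · intro x hx
      obtain ⟨-, h1, h2⟩ := Finset.mem_filter.1 hx
      have h3 : (x.1.1, j) ∈ lam := by rw [← h1]; exact x.2
      exact Finset.mem_range.2 (lt_min h2 (mem_iff_lt_colLen.1 h3))
    · intro x hx y hy hxy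
      obtain ⟨-, h1, -⟩ := Finset.mem_filter.1 hx
      obtain ⟨-, h2, -⟩ := Finset.mem_filter.1 hy
      exact Subtype.ext (Prod.ext hxy (h1.trans h2.symm))
    · intro k hk
      obtain ⟨h1, h2⟩ := lt_min_iff.1 (Finset.mem_range.1 hk)
      exact ⟨⟨(k, j), mem_iff_lt_colLen.2 h2⟩, Finset.mem_filter.2 ⟨Finset.mem_univ _, rfl, h1⟩,
        rfl⟩
  rw [h, Finset.card_range]

variable {lam : YoungDiagram}

theorem card_filter_column_le {h : lam.cells → ℕ}
    (hh : ∀ x y : lam.cells, x.1.2 = y.1.2 → h x = h y → x = y) (i j : ℕ) :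
    (Finset.univ.filter fun x : lam.cells => x.1.2 = j ∧ h x < i).card ≤
      min i (lam.colLen j) := by
  refine le_min ?_ ?_
  · refine (Finset.card_le_card_of_injOn (t := Finset.range i) h ?_ ?_).trans_eq
      (Finset.card_range i)
    · intro x hx
      exact Finset.mem_coe.2 (Finset.mem_range.2 (Finset.mem_filter.1 hx).2.2)
    · intro x hx y hy hxy
      have h1 := (Finset.mem_filter.1 hx).2.1
      have h2 := (Finset.mem_filter.1 hy).2.1
      exact hh x y (h1.trans h2.symm) hxy
  · rw [← min_eq_right (lam.colLen_anti 0 j (Nat.zero_le _)), ← card_filter_snd_lt]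
    refine Finset.card_le_card fun x hx => ?_
    have h1 := (Finset.mem_filter.1 hx).2.1
    refine Finset.mem_filter.2 ⟨Finset.mem_univ _, h1, ?_⟩
    exact fst_lt_of_mem le_rfl x.2

theorem card_filter_eq_sum_columns (h : lam.cells → ℕ) (i : ℕ) :
    (Finset.univ.filter fun x : lam.cells => h x < i).card =
      ∑ j ∈ Finset.univ.image (fun x : lam.cells => x.1.2),
        (Finset.univ.filter fun x : lam.cells => x.1.2 = j ∧ h x < i).card := by
  rw [Finset.card_eq_sum_card_fiberwise (f := fun x : lam.cells => x.1.2)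
    (t := Finset.univ.image (fun x : lam.cells => x.1.2))]
  · refine Finset.sum_congr rfl fun j _ => ?_
    rw [Finset.filter_filter]
    simp only [and_comm]
  · intro x _
    exact Finset.mem_coe.2 (Finset.mem_image_of_mem _ (Finset.mem_univ _))

/-- A labelling of the boxes which is injective on each column is dominated by the row index. -/
theorem card_filter_lt_le {h : lam.cells → ℕ}
    (hh : ∀ x y : lam.cells, x.1.2 = y.1.2 → h x = h y → x = y) (i : ℕ) :
    (Finset.univ.filter fun x : lam.cells => h x < i).card ≤
      (Finset.univ.filter fun x : lam.cells => x.1.1 < i).card := by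
  rw [card_filter_eq_sum_columns, card_filter_eq_sum_columns fun x => x.1.1]
  refine Finset.sum_le_sum fun j _ => ?_
  rw [card_filter_snd_lt]
  exact card_filter_column_le hh i j

/-- Equal totals force equality in every column of `card_filter_column_le`. With i the length of the
column of x, the bound is that whole column, so all its labels are below i. -/
theorem lt_colLen_of_card_eq {h : lam.cells → ℕ}
    (hh : ∀ x y : lam.cells, x.1.2 = y.1.2 → h x = h y → x = y)
    (heq : ∀ i, (Finset.univ.filter fun x : lam.cells => h x < i).card =
      (Finset.univ.filter fun x : lam.cells => x.1.1 < i).card) (x : lam.cells) :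
    h x < lam.colLen x.1.2 := by
  have h1 := heq (lam.colLen x.1.2)
  rw [card_filter_eq_sum_columns, card_filter_eq_sum_columns fun x => x.1.1] at h1
  have h2 := (Finset.sum_eq_sum_iff_of_le (fun j _ => by
    rw [card_filter_snd_lt]
    exact card_filter_column_le hh _ j)).1 h1 x.1.2
      (Finset.mem_image_of_mem (fun x : lam.cells => x.1.2) (Finset.mem_univ x))
  have h3 : (Finset.univ.filter fun y : lam.cells => y.1.2 = x.1.2 ∧ h y < lam.colLen x.1.2) =
      Finset.univ.filter fun y : lam.cells => y.1.2 = x.1.2 ∧ y.1.1 < lam.colLen x.1.2 := by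
    refine Finset.eq_of_subset_of_card_le (fun y hy => ?_) h2.ge
    have h4 := (Finset.mem_filter.1 hy).2.1
    refine Finset.mem_filter.2 ⟨Finset.mem_univ _, h4, ?_⟩
    rw [← h4]
    exact mem_iff_lt_colLen.1 y.2
  have h5 : x ∈ Finset.univ.filter fun y : lam.cells =>
      y.1.2 = x.1.2 ∧ y.1.1 < lam.colLen x.1.2 :=
    Finset.mem_filter.2 ⟨Finset.mem_univ _, rfl, mem_iff_lt_colLen.1 x.2⟩
  rw [← h3] at h5
  exact (Finset.mem_filter.1 h5).2.2

end YoungDiagram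

namespace MonoidAlgebra

variable {G : Type*} [Group G] [Fintype G]

theorem trace_eq_sum_coeff (f : MonoidAlgebra ℝ G →ₗ[ℝ] MonoidAlgebra ℝ G) :
    LinearMap.trace ℝ (MonoidAlgebra ℝ G) f = ∑ g, (f (of ℝ G g)).coeff g := by
  classical
  rw [LinearMap.trace_eq_matrix_trace ℝ (MonoidAlgebra.basis G ℝ), Matrix.trace]
  refine Finset.sum_congr rfl fun g _ => ?_
  rw [Matrix.diag_apply, LinearMap.toMatrix_apply, MonoidAlgebra.basis_apply]
  rfl

end MonoidAlgebra

namespace SymmetricGroup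

open MonoidAlgebra

open Classical in
/-- The sum of the permutations which preserve a colouring of the boxes. -/
noncomputable def colorSymmetrizer {lam : YoungDiagram} {ι : Type*} (f : lam.cells → ι) :
    MonoidAlgebra ℝ (BoxPerm lam) :=
  ∑ g ∈ (Finset.univ : Finset (BoxPerm lam)).filter (fun g => ∀ c, f (g c) = f c), of ℝ _ g

variable {lam : YoungDiagram} {ι : Type*}

theorem perm_apply_inv_apply {X : Type*} (g : Equiv.Perm X) (x : X) : g (g⁻¹ x) = x :=
  g.apply_symm_apply x

theorem perm_inv_apply_apply {X : Type*} (g : Equiv.Perm X) (x : X) : g⁻¹ (g x) = x :=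
  g.symm_apply_apply x

theorem rowSymmetrizer_eq : rowSymmetrizer lam = colorSymmetrizer fun c : lam.cells => c.1.1 := by
  rw [rowSymmetrizer, colorSymmetrizer]
  congr!

theorem colorSymmetrizer_congr {κ : Type*} {f : lam.cells → ι} {f' : lam.cells → κ}
    (h : ∀ x y, f x = f y ↔ f' x = f' y) : colorSymmetrizer f = colorSymmetrizer f' := by
  classical
  rw [colorSymmetrizer, colorSymmetrizer]
  simp only [h]

theorem colorSymmetrizer_mul_of {f : lam.cells → ι} {r : BoxPerm lam} (hr : ∀ c, f (r c) = f c) :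
    colorSymmetrizer f * of ℝ _ r = colorSymmetrizer f := by
  classical
  rw [colorSymmetrizer, Finset.sum_mul]
  refine Finset.sum_bij' (fun g _ => g * r) (fun g _ => g * r⁻¹) ?_ ?_ ?_ ?_ ?_
  · intro g hg
    refine Finset.mem_filter.2 ⟨Finset.mem_univ _, fun c => ?_⟩
    rw [Equiv.Perm.mul_apply, (Finset.mem_filter.1 hg).2, hr]
  · intro g hg
    refine Finset.mem_filter.2 ⟨Finset.mem_univ _, fun c => ?_⟩
    rw [Equiv.Perm.mul_apply, (Finset.mem_filter.1 hg).2, ← hr, perm_apply_inv_apply]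
  · intro g _
    simp
  · intro g _
    simp
  · intro g _
    rw [map_mul]

theorem colorSymmetrizer_mul_self (f : lam.cells → ι) [DecidableEq ι] :
    colorSymmetrizer f * colorSymmetrizer f =
      ((Finset.univ.filter fun g : BoxPerm lam => ∀ c, f (g c) = f c).card : ℝ) •
        colorSymmetrizer f := by
  classical
  conv_lhs => rhs; rw [colorSymmetrizer]
  rw [Finset.mul_sum, Finset.sum_congr rfl fun r hr =>
    colorSymmetrizer_mul_of (by simpa using hr), Finset.sum_const, Nat.cast_smul_eq_nsmul]
  congr!

theorem of_mul_colAntisymmetrizer {c : BoxPerm lam} (hc : ∀ x, (c x).1.2 = x.1.2) :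
    of ℝ _ c * colAntisymmetrizer lam =
      ((Equiv.Perm.sign c : ℤ) : ℝ) • colAntisymmetrizer lam := by
  classical
  have hs : ((Equiv.Perm.sign c : ℤ) : ℝ) * ((Equiv.Perm.sign c : ℤ) : ℝ) = 1 := by
    rw [← Int.cast_mul, ← Units.val_mul, Int.units_mul_self]
    simp
  rw [colAntisymmetrizer, Finset.mul_sum, Finset.smul_sum]
  refine Finset.sum_bij' (fun g _ => c * g) (fun g _ => c⁻¹ * g) ?_ ?_ ?_ ?_ ?_
  · intro g hg
    refine Finset.mem_filter.2 ⟨Finset.mem_univ _, fun x => ?_⟩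
    rw [Equiv.Perm.mul_apply, hc, (Finset.mem_filter.1 hg).2]
  · intro g hg
    refine Finset.mem_filter.2 ⟨Finset.mem_univ _, fun x => ?_⟩
    rw [Equiv.Perm.mul_apply, ← (Finset.mem_filter.1 hg).2 x, ← hc, perm_apply_inv_apply]
  · intro g _
    simp
  · intro g _
    simp
  · intro g _
    rw [mul_smul_comm, ← map_mul, smul_smul, Equiv.Perm.sign_mul, Units.val_mul, Int.cast_mul,
      ← mul_assoc, hs, one_mul]

/-- If two boxes of a column are sent to boxes of the same colour, then the product vanishes. -/
theorem colorSymmetrizer_mul_of_mul_eq_zero {f : lam.cells → ι} {g : BoxPerm lam}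
    {x y : lam.cells} (hxy : x ≠ y) (hcol : x.1.2 = y.1.2) (hf : f (g x) = f (g y)) :
    colorSymmetrizer f * of ℝ _ g * colAntisymmetrizer lam = 0 := by
  classical
  have h1 : ∀ z, ((Equiv.swap x y : BoxPerm lam) z).1.2 = z.1.2 := by
    intro z
    by_cases hzx : z = x
    · rw [hzx, Equiv.swap_apply_left, hcol]
    by_cases hzy : z = y
    · rw [hzy, Equiv.swap_apply_right, hcol]
    rw [Equiv.swap_apply_of_ne_of_ne hzx hzy]
  have h2 : ∀ z, f ((Equiv.swap (g x) (g y) : BoxPerm lam) z) = f z := by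
    intro z
    by_cases hzx : z = g x
    · rw [hzx, Equiv.swap_apply_left, hf]
    by_cases hzy : z = g y
    · rw [hzy, Equiv.swap_apply_right, hf]
    rw [Equiv.swap_apply_of_ne_of_ne hzx hzy]
  have h3 : (Equiv.swap (g x) (g y) : BoxPerm lam) * g = g * Equiv.swap x y :=
    (Equiv.mul_swap_eq_swap_mul g x y).symm
  -- The transposition of g x and g y is absorbed on the left; moved past g it becomes that of x and
  -- y, which the column antisymmetrizer turns into -1.
  have h4 : colorSymmetrizer f * of ℝ _ g * colAntisymmetrizer lam =
      -(colorSymmetrizer f * of ℝ _ g * colAntisymmetrizer lam) := by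
    conv_lhs => rw [← colorSymmetrizer_mul_of h2, mul_assoc (colorSymmetrizer f), ← map_mul, h3,
      map_mul, ← mul_assoc, mul_assoc, of_mul_colAntisymmetrizer h1, Equiv.Perm.sign_swap hxy]
    simp
  have h5 : (2 : ℝ) • (colorSymmetrizer f * of ℝ _ g * colAntisymmetrizer lam) = 0 := by
    rw [two_smul]
    nth_rewrite 1 [h4]
    exact neg_add_cancel _
  exact (smul_eq_zero.1 h5).resolve_left two_ne_zero

/-- If rc = 1 with r preserving rows and c columns, then c preserves both coordinates of every box,
so r = c = 1. -/
theorem coeff_one_youngSymmetrizer : (youngSymmetrizer lam).coeff 1 = 1 := by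
  classical
  rw [youngSymmetrizer, rowSymmetrizer, colAntisymmetrizer, Finset.sum_mul_sum]
  simp only [mul_smul_comm, ← map_mul]
  have h : ∀ r ∈ (Finset.univ : Finset (BoxPerm lam)).filter
      (fun g => ∀ c : lam.cells, (g c).1.1 = c.1.1),
      ∀ c ∈ (Finset.univ : Finset (BoxPerm lam)).filter
      (fun g => ∀ c : lam.cells, (g c).1.2 = c.1.2),
      (((Equiv.Perm.sign c : ℤ) : ℝ) • of ℝ (BoxPerm lam) (r * c)).coeff 1 =
        if r = 1 then (if c = 1 then 1 else 0) else 0 := by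
    intro r hr c hc
    rw [coeff_smul_apply, of_apply, coeff_single, Finsupp.single_apply]
    have hr' := (Finset.mem_filter.1 hr).2
    have hc' := (Finset.mem_filter.1 hc).2
    by_cases h1 : r * c = 1
    · have h2 : c = 1 := by
        ext1 x
        have h3 : r (c x) = x := by rw [← Equiv.Perm.mul_apply, h1, Equiv.Perm.one_apply]
        refine Subtype.ext (Prod.ext ?_ (hc' x))
        rw [Equiv.Perm.one_apply, ← hr', h3]
      have h3 : r = 1 := by rw [← h1, h2, mul_one]
      rw [if_pos h1, if_pos h3, if_pos h2, h2]
      simp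
    · rw [if_neg h1, smul_zero]
      split_ifs with h2 h3
      · exact absurd (by rw [h2, h3, mul_one]) h1
      · rfl
      · rfl
  rw [coeff_sum, Finset.sum_apply']
  simp only [coeff_sum, Finset.sum_apply']
  rw [Finset.sum_congr rfl fun r hr => Finset.sum_congr rfl fun c hc => h r hr c hc]
  simp

/-- Von Neumann's lemma on group elements. -/
theorem exists_rowSymmetrizer_mul_of_mul (g : BoxPerm lam) :
    ∃ s : ℝ, rowSymmetrizer lam * of ℝ _ g * colAntisymmetrizer lam =
      s • youngSymmetrizer lam := by
  classical
  by_cases hh : ∀ x y : lam.cells, x.1.2 = y.1.2 → (g x).1.1 = (g y).1.1 → x = y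
  · have hlt := YoungDiagram.lt_colLen_of_card_eq (h := fun x => (g x).1.1) hh (fun i =>
      Finset.card_bij (fun x _ => g x)
        (fun x hx => Finset.mem_filter.2 ⟨Finset.mem_univ _, (Finset.mem_filter.1 hx).2⟩)
        (fun x _ y _ h => g.injective h)
        (fun y hy => ⟨g⁻¹ y, Finset.mem_filter.2 ⟨Finset.mem_univ _, by
          simpa using (Finset.mem_filter.1 hy).2⟩, by simp⟩))
    -- Factor g = rc: c moves x inside its column to the row of g x, a box of the diagram by `hlt`,
    -- and the remaining r = g c⁻¹ preserves rows.
    let c₀ : lam.cells → lam.cells := fun x =>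
      ⟨((g x).1.1, x.1.2), YoungDiagram.mem_iff_lt_colLen.2 (hlt x)⟩
    have hc₀ : Function.Injective c₀ := by
      intro x y hxy
      have h1 := congrArg (fun z : lam.cells => z.1.1) hxy
      have h2 := congrArg (fun z : lam.cells => z.1.2) hxy
      exact hh x y h2 h1
    let c : BoxPerm lam := Equiv.ofBijective c₀ (Finite.injective_iff_bijective.1 hc₀)
    have hc : ∀ x, (c x).1.2 = x.1.2 := fun x => rfl
    have hr : ∀ x, ((g * c⁻¹) x).1.1 = x.1.1 := by
      intro x
      obtain ⟨y, rfl⟩ := c.surjective x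
      rw [Equiv.Perm.mul_apply, perm_inv_apply_apply]
      rfl
    refine ⟨((Equiv.Perm.sign c : ℤ) : ℝ), ?_⟩
    have hg : g = (g * c⁻¹) * c := by simp
    rw [hg, map_mul, ← mul_assoc, youngSymmetrizer, rowSymmetrizer_eq,
      colorSymmetrizer_mul_of hr, mul_assoc, of_mul_colAntisymmetrizer hc, mul_smul_comm]
  · push Not at hh
    obtain ⟨x, y, h1, h2, h3⟩ := hh
    refine ⟨0, ?_⟩
    rw [zero_smul, rowSymmetrizer_eq]
    exact colorSymmetrizer_mul_of_mul_eq_zero h3 h1 h2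

end SymmetricGroup

/-! ### Characters of Specht modules as traces on the group algebra. -/

namespace SymmetricGroup

open MonoidAlgebra

variable {lam : YoungDiagram} {ι : Type*}

/-- The coefficient at the identity of `R x C`, where `R` and `C` are the row symmetrizer and the
column antisymmetrizer. -/
noncomputable def sandwichCoeff (lam : YoungDiagram) : MonoidAlgebra ℝ (BoxPerm lam) →ₗ[ℝ] ℝ where
  toFun x := (rowSymmetrizer lam * x * colAntisymmetrizer lam).coeff 1
  map_add' x y := by rw [mul_add, add_mul, coeff_add, Finsupp.add_apply]
  map_smul' a x := by
    rw [mul_smul_comm, smul_mul_assoc, coeff_smul_apply, RingHom.id_apply]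

theorem rowSymmetrizer_mul_mul (x : MonoidAlgebra ℝ (BoxPerm lam)) :
    rowSymmetrizer lam * x * colAntisymmetrizer lam =
      sandwichCoeff lam x • youngSymmetrizer lam := by
  induction x using MonoidAlgebra.induction_on with
  | of g =>
    obtain ⟨s, hs⟩ := exists_rowSymmetrizer_mul_of_mul g
    have h : sandwichCoeff lam (of ℝ _ g) = s := by
      change (rowSymmetrizer lam * of ℝ _ g * colAntisymmetrizer lam).coeff 1 = s
      rw [hs, coeff_smul_apply, coeff_one_youngSymmetrizer, smul_eq_mul, mul_one]
    rw [h, hs]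
  | add x y hx hy => rw [mul_add, add_mul, hx, hy, map_add, add_smul]
  | smul a x hx => rw [mul_smul_comm, smul_mul_assoc, hx, map_smul, smul_eq_mul, mul_smul]

/-- The factor `n` with `e * e = n • e` for the Young symmetrizer `e`. -/
noncomputable def hookFactor (lam : YoungDiagram) : ℝ :=
  sandwichCoeff lam (colAntisymmetrizer lam * rowSymmetrizer lam)

theorem youngSymmetrizer_mul_self : youngSymmetrizer lam * youngSymmetrizer lam =
    hookFactor lam • youngSymmetrizer lam := by
  rw [hookFactor, ← rowSymmetrizer_mul_mul, youngSymmetrizer]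
  simp only [mul_assoc]

theorem sandwichCoeff_of_eq {x : MonoidAlgebra ℝ (BoxPerm lam)} {s : ℝ}
    (h : rowSymmetrizer lam * x * colAntisymmetrizer lam = s • youngSymmetrizer lam) :
    sandwichCoeff lam x = s := by
  have h1 := congrArg (fun y => y.coeff 1) ((rowSymmetrizer_mul_mul x).symm.trans h)
  simpa only [coeff_smul_apply, coeff_one_youngSymmetrizer, smul_eq_mul, mul_one] using h1

/-- Otherwise right multiplication by the Young symmetrizer squares to zero and has trace 0; but its
trace is the group order, since the symmetrizer has coefficient 1 at the identity. -/
theorem hookFactor_ne_zero : hookFactor lam ≠ 0 := by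
  intro h
  have h1 : IsNilpotent (LinearMap.mulRight ℝ (youngSymmetrizer lam)) := by
    refine ⟨2, ?_⟩
    rw [LinearMap.pow_mulRight, pow_two, youngSymmetrizer_mul_self, h, zero_smul,
      LinearMap.mulRight_zero_eq_zero]
  have h2 := (LinearMap.isNilpotent_trace_of_isNilpotent h1).eq_zero
  rw [trace_eq_sum_coeff] at h2
  have h3 : ∀ g : BoxPerm lam, (LinearMap.mulRight ℝ (youngSymmetrizer lam)
      (of ℝ _ g)).coeff g = 1 := by
    intro g
    rw [LinearMap.mulRight_apply, of_apply, coeff_single_mul_apply, one_mul, inv_mul_cancel,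
      coeff_one_youngSymmetrizer]
  rw [Finset.sum_congr rfl fun g _ => h3 g] at h2
  simp at h2

/-- The character of the Specht module, extended to the group algebra. -/
theorem irrChar_eq_trace (g : BoxPerm lam) : irrChar lam g = (hookFactor lam)⁻¹ *
    LinearMap.trace ℝ _ (LinearMap.mulLeft ℝ (of ℝ (BoxPerm lam) g) ∘ₗ
      LinearMap.mulRight ℝ (youngSymmetrizer lam)) := by
  rw [← smul_eq_mul, ← map_smul]
  -- Right multiplication by e, divided by `hookFactor`, projects onto the Specht module, so the
  -- trace on the module can be taken on the whole algebra.
  have hmem : ∀ x, ((hookFactor lam)⁻¹ • (LinearMap.mulLeft ℝ (of ℝ (BoxPerm lam) g) ∘ₗ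
      LinearMap.mulRight ℝ (youngSymmetrizer lam))) x ∈ spechtModule lam := by
    intro x
    refine Submodule.smul_mem _ _ ⟨of ℝ (BoxPerm lam) g * x, ?_⟩
    simp [mul_assoc]
  rw [← LinearMap.trace_restrict_eq_of_forall_mem (spechtModule lam) _ hmem]
  change LinearMap.trace ℝ _ (spechtRep lam g) = _
  congr 1
  apply LinearMap.ext
  rintro ⟨_, z, rfl⟩
  apply Subtype.ext
  change of ℝ (BoxPerm lam) g * (z * youngSymmetrizer lam) = (hookFactor lam)⁻¹ •
    (of ℝ (BoxPerm lam) g * (z * youngSymmetrizer lam * youngSymmetrizer lam))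
  rw [mul_assoc z, youngSymmetrizer_mul_self, mul_smul_comm, mul_smul_comm, smul_smul,
    inv_mul_cancel₀ hookFactor_ne_zero, one_smul]

theorem irrChar_eq_of_isConj {g h : BoxPerm lam} (e : IsConj g h) :
    irrChar lam g = irrChar lam h := by
  obtain ⟨k, rfl⟩ := isConj_iff.1 e
  exact ((spechtRep lam).char_conj g k).symm

theorem trace_mulLeft_mulRight_eq_zero {y : MonoidAlgebra ℝ (BoxPerm lam)}
    (h : ∀ g : BoxPerm lam, y * of ℝ _ g * colAntisymmetrizer lam = 0) :
    LinearMap.trace ℝ _ (LinearMap.mulLeft ℝ y ∘ₗ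
      LinearMap.mulRight ℝ (youngSymmetrizer lam)) = 0 := by
  have h1 : ∀ x, y * x * colAntisymmetrizer lam = 0 := by
    intro x
    induction x using MonoidAlgebra.induction_on with
    | of g => exact h g
    | add x z hx hz => rw [mul_add, add_mul, hx, hz, add_zero]
    | smul a x hx => rw [mul_smul_comm, smul_mul_assoc, hx, smul_zero]
  have h2 : LinearMap.mulLeft ℝ y ∘ₗ LinearMap.mulRight ℝ (youngSymmetrizer lam) = 0 := by
    apply LinearMap.ext
    intro x
    have := h1 (x * rowSymmetrizer lam)
    simpa [youngSymmetrizer, mul_assoc] using this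
  rw [h2, map_zero]

/-- With R and C the row symmetrizer and column antisymmetrizer, x ↦ R z x R C has rank at most one
by von Neumann's lemma. Its trace is the scalar by which it acts on e = RC. -/
theorem trace_rowSymmetrizer_mul (z : MonoidAlgebra ℝ (BoxPerm lam)) {s : ℝ}
    (h : rowSymmetrizer lam * z * rowSymmetrizer lam * colAntisymmetrizer lam *
      rowSymmetrizer lam * colAntisymmetrizer lam = s • youngSymmetrizer lam) :
    LinearMap.trace ℝ _ (LinearMap.mulLeft ℝ (rowSymmetrizer lam * z) ∘ₗ
      LinearMap.mulRight ℝ (youngSymmetrizer lam)) = s := by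
  have h1 : LinearMap.mulLeft ℝ (rowSymmetrizer lam * z) ∘ₗ
      LinearMap.mulRight ℝ (youngSymmetrizer lam) =
      (sandwichCoeff lam ∘ₗ LinearMap.mulLeft ℝ z ∘ₗ
        LinearMap.mulRight ℝ (rowSymmetrizer lam)).smulRight (youngSymmetrizer lam) := by
    apply LinearMap.ext
    intro x
    rw [LinearMap.smulRight_apply]
    simp only [LinearMap.comp_apply, LinearMap.mulLeft_apply, LinearMap.mulRight_apply]
    rw [← rowSymmetrizer_mul_mul, youngSymmetrizer]
    simp only [mul_assoc]
  rw [h1, LinearMap.trace_smulRight]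
  refine sandwichCoeff_of_eq ?_
  rw [← h, youngSymmetrizer]
  simp only [LinearMap.comp_apply, LinearMap.mulLeft_apply, LinearMap.mulRight_apply, mul_assoc]

theorem sum_irrChar_mul {y : MonoidAlgebra ℝ (BoxPerm lam)} :
    ∑ g, irrChar lam g * y.coeff g = (hookFactor lam)⁻¹ *
      LinearMap.trace ℝ _ (LinearMap.mulLeft ℝ y ∘ₗ
        LinearMap.mulRight ℝ (youngSymmetrizer lam)) := by
  induction y using MonoidAlgebra.induction_on with
  | of g =>
    classical
    rw [← irrChar_eq_trace, Finset.sum_eq_single g]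
    · simp
    · intro h _ hne
      rw [of_apply, coeff_single, Finsupp.single_apply, if_neg (Ne.symm hne), mul_zero]
    · simp
  | add x y hx hy =>
    have h : LinearMap.mulLeft ℝ (x + y) = LinearMap.mulLeft ℝ x + LinearMap.mulLeft ℝ y := by
      ext; simp [add_mul]
    rw [h, LinearMap.add_comp, map_add, mul_add, ← hx, ← hy,
      ← Finset.sum_add_distrib]
    simp [mul_add]
  | smul a x hx =>
    have : LinearMap.mulLeft ℝ (a • x) = a • LinearMap.mulLeft ℝ x := by
      ext; simp
    rw [this, LinearMap.smul_comp, map_smul, smul_eq_mul, mul_left_comm, ← hx, Finset.mul_sum]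
    refine Finset.sum_congr rfl fun g _ => ?_
    rw [coeff_smul_apply, smul_eq_mul]
    ring

theorem sum_filter_irrChar [DecidableEq ι] (f : lam.cells → ι) :
    ∑ g ∈ Finset.univ.filter (fun g : BoxPerm lam => ∀ c, f (g c) = f c), irrChar lam g =
      (hookFactor lam)⁻¹ * LinearMap.trace ℝ _ (LinearMap.mulLeft ℝ (colorSymmetrizer f) ∘ₗ
        LinearMap.mulRight ℝ (youngSymmetrizer lam)) := by
  classical
  rw [← sum_irrChar_mul, Finset.sum_filter]
  refine Finset.sum_congr rfl fun g _ => ?_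
  rw [colorSymmetrizer, coeff_sum, Finset.sum_apply']
  simp only [of_apply, coeff_single, Finsupp.single_apply]
  rw [Finset.sum_ite_eq' _ g]
  simp

/-- With R² = |R|·R for the row group, the rank-one trace is |R| times `hookFactor`: χ^λ averages to
1 over the row group. -/
theorem sum_filter_irrChar_row [DecidableEq ι] {f : lam.cells → ι}
    (hf : ∀ x y, f x = f y ↔ x.1.1 = y.1.1) :
    ∑ g ∈ Finset.univ.filter (fun g : BoxPerm lam => ∀ c, f (g c) = f c), irrChar lam g =
      ((Finset.univ.filter (fun g : BoxPerm lam => ∀ c, f (g c) = f c)).card : ℝ) := by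
  have h1 : rowSymmetrizer lam = colorSymmetrizer f :=
    rowSymmetrizer_eq.trans (colorSymmetrizer_congr fun x y => (hf x y).symm)
  have h2 := colorSymmetrizer_mul_self f
  rw [← h1] at h2
  rw [sum_filter_irrChar, ← h1, ← mul_one (rowSymmetrizer lam), trace_rowSymmetrizer_mul 1
    (s := ((Finset.univ.filter (fun g : BoxPerm lam => ∀ c, f (g c) = f c)).card : ℝ) *
      hookFactor lam)]
  · rw [mul_left_comm, inv_mul_cancel₀ hookFactor_ne_zero, mul_one]
  · rw [mul_one, h2, mul_smul, ← youngSymmetrizer_mul_self, youngSymmetrizer]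
    simp only [smul_mul_assoc, mul_assoc]

/-- By `h1` the character is the conjugation average of the coefficients of e, up to `hookFactor`.
As χ is invariant under conjugation and inversion, the norm reduces to the value of χ on e. -/
theorem sum_irrChar_mul_self :
    ∑ g, irrChar lam g * irrChar lam g = ((Fintype.card (BoxPerm lam) : ℕ) : ℝ) := by
  have h1 : ∀ g : BoxPerm lam, irrChar lam g = (hookFactor lam)⁻¹ *
      ∑ h : BoxPerm lam, (youngSymmetrizer lam).coeff (h⁻¹ * g⁻¹ * h) := by
    intro g
    rw [irrChar_eq_trace, trace_eq_sum_coeff]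
    refine congrArg (fun s : ℝ => (hookFactor lam)⁻¹ * s) (Finset.sum_congr rfl fun h _ => ?_)
    rw [LinearMap.comp_apply, LinearMap.mulLeft_apply, LinearMap.mulRight_apply, ← mul_assoc,
      ← map_mul, of_apply, coeff_single_mul_apply, one_mul, mul_inv_rev]
  have hinv : ∀ g : BoxPerm lam, irrChar lam g⁻¹ = irrChar lam g := fun g =>
    irrChar_eq_of_isConj (Equiv.Perm.isConj_iff_cycleType_eq.2 (Equiv.Perm.cycleType_inv g))
  have h2 : ∀ h : BoxPerm lam, ∑ g : BoxPerm lam,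
      irrChar lam g * (youngSymmetrizer lam).coeff (h⁻¹ * g⁻¹ * h) =
        ∑ g, irrChar lam g * (youngSymmetrizer lam).coeff g := by
    intro h
    rw [← Equiv.sum_comp ((Equiv.inv (BoxPerm lam)).trans (MulAut.conj h).toEquiv)]
    refine Finset.sum_congr rfl fun g _ => ?_
    have h3 : ((Equiv.inv (BoxPerm lam)).trans (MulAut.conj h).toEquiv) g = h * g⁻¹ * h⁻¹ := rfl
    have h4 : h⁻¹ * (h * g⁻¹ * h⁻¹)⁻¹ * h = g := by group
    have h5 : IsConj (h * g⁻¹ * h⁻¹) g⁻¹ := isConj_iff.2 ⟨h⁻¹, by group⟩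
    rw [h3, h4, irrChar_eq_of_isConj h5, hinv]
  -- The trace of x ↦ e x e is the square of `hookFactor`, and one factor cancels.
  have h4 : ∑ g, irrChar lam g * (youngSymmetrizer lam).coeff g = hookFactor lam := by
    have h := trace_rowSymmetrizer_mul (colAntisymmetrizer lam)
      (s := hookFactor lam * hookFactor lam) ?_
    · rw [← youngSymmetrizer] at h
      rw [sum_irrChar_mul, h, inv_mul_cancel_left₀ hookFactor_ne_zero]
    · rw [mul_smul, ← youngSymmetrizer_mul_self, ← smul_mul_assoc, ← youngSymmetrizer_mul_self,
        youngSymmetrizer]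
      simp only [mul_assoc]
  have h5 : ∑ g, irrChar lam g * irrChar lam g = (hookFactor lam)⁻¹ *
      ∑ h : BoxPerm lam, ∑ g : BoxPerm lam,
        irrChar lam g * (youngSymmetrizer lam).coeff (h⁻¹ * g⁻¹ * h) := by
    rw [Finset.sum_comm, Finset.mul_sum]
    refine Finset.sum_congr rfl fun g _ => ?_
    conv_lhs => rhs; rw [h1]
    rw [mul_left_comm, Finset.mul_sum]
  rw [h5, Finset.sum_congr rfl fun h _ => (h2 h).trans h4, Finset.sum_const, nsmul_eq_mul,
    mul_left_comm, inv_mul_cancel₀ hookFactor_ne_zero, mul_one, Finset.card_univ]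

open SymFun

theorem sum_fin_lt {N : ℕ} (f : lam.cells → Fin N) (i : Fin N) :
    (Finset.univ.filter fun x : lam.cells => (f x : ℕ) < (i : ℕ) + 1).card =
      ∑ j ∈ Finset.univ.filter (fun j : Fin N => j ≤ i), Fintype.card {x // f x = j} := by
  rw [Finset.card_eq_sum_card_fiberwise (f := f)
    (t := Finset.univ.filter (fun j : Fin N => j ≤ i))]
  · refine Finset.sum_congr rfl fun j hj => ?_
    have hj' := (Finset.mem_filter.1 hj).2
    rw [Fintype.card_subtype, Finset.filter_filter]
    congr 1
    refine Finset.filter_congr fun x _ => ?_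
    constructor
    · exact fun h => h.2
    · rintro rfl
      exact ⟨Nat.lt_succ_of_le hj', rfl⟩
  · intro x hx
    exact Finset.mem_coe.2 (Finset.mem_filter.2 ⟨Finset.mem_univ _,
      Nat.lt_succ_iff.1 (Finset.mem_filter.1 hx).2⟩)

/-- The row index as a colouring. -/
def rowColor (lam : YoungDiagram) (x : lam.cells) : Fin lam.card :=
  ⟨x.1.1, YoungDiagram.fst_lt_of_mem lam.colLen_zero_le_card x.2⟩

theorem rowColor_eq_iff (x y : lam.cells) : rowColor lam x = rowColor lam y ↔ x.1.1 = y.1.1 :=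
  Fin.ext_iff

theorem card_rowColor_fiber (i : Fin lam.card) :
    Fintype.card {x // rowColor lam x = i} = lam.rowLen i := by
  rw [← YoungDiagram.card_filter_fst_eq, Fintype.card_subtype]
  refine Finset.card_bij (fun x _ => x.1) ?_ ?_ ?_
  · intro x hx
    exact Finset.mem_filter.2 ⟨x.2, congrArg Fin.val (Finset.mem_filter.1 hx).2⟩
  · intro x _ y _ h
    exact Subtype.ext h
  · intro c hc
    obtain ⟨h1, h2⟩ := Finset.mem_filter.1 hc
    exact ⟨⟨c, h1⟩, Finset.mem_filter.2 ⟨Finset.mem_univ _, Fin.ext h2⟩, rfl⟩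

/-- If some product with g survived, f ∘ g would be injective on columns, so the partial sums of
fiber sizes would not exceed those of row lengths. At the first place where the sizes differ they
do. -/
theorem sum_filter_irrChar_eq_zero {f : lam.cells → Fin lam.card}
    (hf : toLex (fun i : Fin lam.card => lam.rowLen i) <
      toLex fun i => Fintype.card {x // f x = i}) :
    ∑ g ∈ Finset.univ.filter (fun g : BoxPerm lam => ∀ c, f (g c) = f c), irrChar lam g = 0 := by
  rw [sum_filter_irrChar, trace_mulLeft_mulRight_eq_zero, mul_zero]
  intro g
  by_contra hne
  have hh : ∀ x y : lam.cells, x.1.2 = y.1.2 → (f (g x) : ℕ) = f (g y) → x = y := by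
    intro x y h1 h2
    by_contra hxy
    exact hne (colorSymmetrizer_mul_of_mul_eq_zero hxy h1 (Fin.ext h2))
  obtain ⟨i, hi1, hi2⟩ := toLex_lt_iff.1 hf
  have h1 := YoungDiagram.card_filter_lt_le (h := fun x => (f (g x) : ℕ)) hh ((i : ℕ) + 1)
  have h2 : (Finset.univ.filter fun x : lam.cells => (f (g x) : ℕ) < (i : ℕ) + 1).card =
      (Finset.univ.filter fun x : lam.cells => (f x : ℕ) < (i : ℕ) + 1).card :=
    Finset.card_bij (fun x _ => g x)
        (fun x hx => Finset.mem_filter.2 ⟨Finset.mem_univ _, (Finset.mem_filter.1 hx).2⟩)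
        (fun x _ y _ h => g.injective h)
        (fun y hy => ⟨g⁻¹ y, Finset.mem_filter.2 ⟨Finset.mem_univ _, by
          simpa using (Finset.mem_filter.1 hy).2⟩, by simp⟩)
  have h3 := sum_fin_lt (rowColor lam) i
  rw [h2, sum_fin_lt] at h1
  change (Finset.univ.filter fun x : lam.cells => x.1.1 < (i : ℕ) + 1).card = _ at h3
  rw [h3] at h1
  refine absurd h1 (not_le.2 (Finset.sum_lt_sum ?_ ⟨i, ?_, ?_⟩))
  · intro j hj
    rw [card_rowColor_fiber]
    rcases lt_or_eq_of_le (Finset.mem_filter.1 hj).2 with h | h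
    · exact (hi1 j h).le
    · rw [h]
      exact hi2.le
  · exact Finset.mem_filter.2 ⟨Finset.mem_univ _, le_rfl⟩
  · rw [card_rowColor_fiber]
    exact hi2

theorem exists_coloring {N : ℕ} {b : Fin N → ℕ} (hb : ∑ i, b i = lam.card) :
    ∃ f : lam.cells → Fin N, ∀ i, Fintype.card {x // f x = i} = b i := by
  have h : Fintype.card lam.cells = Fintype.card (Σ i, Fin (b i)) := by
    rw [Fintype.card_sigma, Fintype.card_coe]
    simp only [Fintype.card_fin]
    exact hb.symm
  let e := Fintype.equivOfCardEq h
  refine ⟨fun x => (e x).1, fun i => ?_⟩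
  have e2 : {x : lam.cells // (e x).1 = i} ≃ {s : Σ i, Fin (b i) // s.1 = i} :=
    e.subtypeEquiv fun x => Iff.rfl
  rw [Fintype.card_congr (e2.trans (Equiv.sigmaSubtype i)), Fintype.card_fin]

/-- The Frobenius characteristic of the irreducible character is the Schur function. -/
theorem charMap_irrChar : charMap (irrChar lam) = schur lam := by
  have hcl : ∀ g h : BoxPerm lam, IsConj g h → irrChar lam g = irrChar lam h :=
    fun g h => irrChar_eq_of_isConj
  have h1 : pairing (charMap (irrChar lam)) (charMap (irrChar lam)) = 1 := by
    rw [pairing_charMap_self hcl, sum_irrChar_mul_self, Fintype.card_perm, inv_mul_cancel₀]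
    positivity
  have h2 : pairing (charMap (irrChar lam))
      (∏ i : Fin lam.card, complete (lam.rowLen i)) = 1 := by
    have h := pairing_charMap_prod_complete hcl (rowColor lam)
    rw [sum_filter_irrChar_row rowColor_eq_iff, Equiv.Perm.card_filter_preserving] at h
    simp only [card_rowColor_fiber] at h
    push_cast at h
    refine mul_left_cancel₀ ?_ (h.trans (mul_one _).symm)
    exact Finset.prod_ne_zero_iff.2 fun i _ => by positivity
  -- In the expansion of s_λ every product other than the diagonal one has a lexicographically
  -- larger type, over whose Young subgroup χ^λ sums to 0.
  have h3 : pairing (charMap (irrChar lam)) (schur lam) = 1 := by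
    rw [schur_eq_jacobiTrudi_card rfl, apply_jacobiTrudi, h2]
    intro b hb hlt
    rw [lam.sum_rowLen lam.colLen_zero_le_card] at hb
    obtain ⟨f, hf⟩ := exists_coloring hb
    have h := pairing_charMap_prod_complete hcl f
    rw [sum_filter_irrChar_eq_zero (by simpa only [hf] using hlt)] at h
    simp only [hf] at h
    refine (mul_eq_zero.1 h).resolve_left ?_
    exact Finset.prod_ne_zero_iff.2 fun i _ => by positivity
  -- The difference has squared norm 1 - 1 - 1 + 1 = 0.
  rw [← sub_eq_zero]
  apply eq_zero_of_pairing_self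
  rw [map_sub, map_sub, LinearMap.sub_apply, LinearMap.sub_apply, h1, h3, pairing_comm (schur lam), h3,
    pairing_schur_self]
  ring

end SymmetricGroup

/-! ### Thoma measures and controlling measures -/

namespace ThomaSimplex

theorem continuous_coords : Continuous fun ω : ThomaSimplex => (ω.α, ω.β) :=
  continuous_induced_dom

theorem continuous_α (i : ℕ) : Continuous fun ω : ThomaSimplex => ω.α i :=
  (continuous_apply i).comp continuous_coords.fst

theorem continuous_β (i : ℕ) : Continuous fun ω : ThomaSimplex => ω.β i :=
  (continuous_apply i).comp continuous_coords.snd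

theorem summable_α (ω : ThomaSimplex) : Summable ω.α :=
  Summable.of_nonneg_of_le ω.α_nonneg (fun i => le_add_of_nonneg_right (ω.β_nonneg i))
    ω.hasSum.summable

theorem summable_β (ω : ThomaSimplex) : Summable ω.β :=
  Summable.of_nonneg_of_le ω.β_nonneg (fun i => le_add_of_nonneg_left (ω.α_nonneg i))
    ω.hasSum.summable

theorem tsum_add_tsum_add (ω : ThomaSimplex) : (∑' i, ω.α i) + (∑' i, ω.β i) + ω.γ = 1 := by
  rw [← ω.summable_α.tsum_add ω.summable_β, ω.hasSum.tsum_eq]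
  ring

/-- γ is not continuous in this topology, since mass can escape into ever smaller α_i; it is Borel
as 1 minus countable sums of coordinates. -/
theorem measurable_γ : Measurable ThomaSimplex.γ := by
  have h : ThomaSimplex.γ = fun ω =>
      1 - (∑' i, ENNReal.ofReal (ω.α i)).toReal - (∑' i, ENNReal.ofReal (ω.β i)).toReal := by
    funext ω
    rw [← ENNReal.ofReal_tsum_of_nonneg ω.α_nonneg ω.summable_α,
      ← ENNReal.ofReal_tsum_of_nonneg ω.β_nonneg ω.summable_β,
      ENNReal.toReal_ofReal (tsum_nonneg ω.α_nonneg),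
      ENNReal.toReal_ofReal (tsum_nonneg ω.β_nonneg)]
    linarith [ω.tsum_add_tsum_add]
  rw [h]
  refine Measurable.sub (Measurable.sub measurable_const ?_) ?_
  · exact (Measurable.tsum fun i => (continuous_α i).measurable.ennreal_ofReal).ennreal_toReal
  · exact (Measurable.tsum fun i => (continuous_β i).measurable.ennreal_ofReal).ennreal_toReal

instance isProbabilityMeasure_thomaMeasure (ω : ThomaSimplex) :
    IsProbabilityMeasure (thomaMeasure ω) := by
  constructor
  rw [thomaMeasure, Measure.add_apply, Measure.add_apply, Measure.sum_apply _ MeasurableSet.univ,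
    Measure.sum_apply _ MeasurableSet.univ]
  simp only [Measure.smul_apply, measure_univ, smul_eq_mul, mul_one]
  rw [← ENNReal.ofReal_tsum_of_nonneg ω.α_nonneg ω.summable_α,
    ← ENNReal.ofReal_tsum_of_nonneg ω.β_nonneg ω.summable_β,
    ← ENNReal.ofReal_add (tsum_nonneg ω.α_nonneg) (tsum_nonneg ω.β_nonneg),
    ← ENNReal.ofReal_add (add_nonneg (tsum_nonneg ω.α_nonneg) (tsum_nonneg ω.β_nonneg))
      ω.γ_nonneg, tsum_add_tsum_add, ENNReal.ofReal_one]

theorem measurable_thomaMeasure : Measurable thomaMeasure := by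
  refine Measure.measurable_of_measurable_coe _ fun s hs => ?_
  simp only [thomaMeasure, Measure.add_apply, Measure.sum_apply _ hs, Measure.smul_apply,
    smul_eq_mul]
  have hpos : ∀ i, Measurable fun ω : ThomaSimplex => ω.posPoint i := fun i =>
    ((continuous_α i).subtype_mk _).measurable
  have hneg : ∀ i, Measurable fun ω : ThomaSimplex => ω.negPoint i := fun i =>
    ((continuous_β i).neg.subtype_mk _).measurable
  refine Measurable.add (Measurable.add (Measurable.tsum fun i => ?_)
    (Measurable.tsum fun i => ?_)) ?_
  · exact (continuous_α i).measurable.ennreal_ofReal.mul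
      ((Measure.measurable_coe hs).comp (Measure.measurable_dirac.comp (hpos i)))
  · exact (continuous_β i).measurable.ennreal_ofReal.mul
      ((Measure.measurable_coe hs).comp (Measure.measurable_dirac.comp (hneg i)))
  · exact measurable_γ.ennreal_ofReal.mul measurable_const

/-- Measurable boxes form a generating π-system, and on a box the product measure is a finite
product of measurable functions. -/
theorem measurable_pi_thomaMeasure (n : ℕ) :
    Measurable fun ω => Measure.pi fun _ : Fin n => thomaMeasure ω := by
  refine Measurable.measure_of_isPiSystem_of_isProbabilityMeasure generateFrom_pi.symm
    isPiSystem_pi ?_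
  rintro _ ⟨s, hs, rfl⟩
  simp only [Measure.pi_pi]
  refine Finset.measurable_prod _ fun i _ => ?_
  have hsi : MeasurableSet (s i) := hs i (Set.mem_univ i)
  exact (Measure.measurable_coe hsi).comp measurable_thomaMeasure

/-- The measures `ν_ω^{×n}` as a Markov kernel. -/
noncomputable def thomaKernel (n : ℕ) :
    ProbabilityTheory.Kernel ThomaSimplex (Fin n → Set.Icc (-1 : ℝ) 1) :=
  ⟨fun ω => Measure.pi fun _ : Fin n => thomaMeasure ω, measurable_pi_thomaMeasure n⟩

theorem thomaKernel_apply (n : ℕ) (ω : ThomaSimplex) :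
    thomaKernel n ω = Measure.pi fun _ : Fin n => thomaMeasure ω := rfl

instance (n : ℕ) : ProbabilityTheory.IsMarkovKernel (thomaKernel n) :=
  ⟨fun ω => by rw [thomaKernel_apply]; infer_instance⟩

/-- As a composition of kernels the measure inherits total mass 1 and the iterated integral formula.
-/
theorem controllingMeasure_eq_comp (P : Measure ThomaSimplex) (n : ℕ) : controllingMeasure P n =
    ((thomaKernel n).comp (ProbabilityTheory.Kernel.const Unit P)) () := by
  rw [ProbabilityTheory.Kernel.comp_apply, ProbabilityTheory.Kernel.const_apply]
  rfl

theorem isProbabilityMeasure_controllingMeasure (P : Measure ThomaSimplex)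
    [IsProbabilityMeasure P] (n : ℕ) : IsProbabilityMeasure (controllingMeasure P n) := by
  rw [controllingMeasure_eq_comp]
  infer_instance

theorem integral_pow_thomaMeasure (ω : ThomaSimplex) (l : ℕ) :
    ∫ x, (x : ℝ) ^ l ∂(thomaMeasure ω) = extPowerSum (l + 1) ω := by
  have hint : Integrable (fun x : Set.Icc (-1 : ℝ) 1 => (x : ℝ) ^ l) (thomaMeasure ω) := by
    refine Integrable.of_bound (by fun_prop : Continuous fun x : Set.Icc (-1 : ℝ) 1 =>
      (x : ℝ) ^ l).aestronglyMeasurable 1 (Filter.Eventually.of_forall fun x => ?_)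
    rw [norm_pow]
    exact pow_le_one₀ (norm_nonneg _) (abs_le.2 x.2)
  have h12 := (integrable_add_measure.1 hint).1
  have h3 := (integrable_add_measure.1 hint).2
  have h1 := (integrable_add_measure.1 h12).1
  have h2 := (integrable_add_measure.1 h12).2
  rw [thomaMeasure, integral_add_measure h12 h3, integral_add_measure h1 h2,
    integral_sum_measure h1, integral_sum_measure h2]
  simp only [integral_smul_measure, integral_dirac, smul_eq_mul,
    ENNReal.toReal_ofReal (ω.α_nonneg _), ENNReal.toReal_ofReal (ω.β_nonneg _),
    ENNReal.toReal_ofReal ω.γ_nonneg, posPoint, negPoint]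
  -- γ · 0^l is γ for l = 0 and 0 otherwise, which is exactly the case split in `extPowerSum`.
  rcases Nat.eq_zero_or_pos l with rfl | hl
  · simp [extPowerSum]
  · rw [extPowerSum, if_neg (by omega), zero_pow hl.ne', mul_zero, add_zero, Nat.add_sub_cancel,
      ← tsum_mul_left]
    congr 1
    · exact tsum_congr fun i => (pow_succ' _ _).symm
    · refine tsum_congr fun i => ?_
      rw [neg_pow, pow_succ]
      ring

theorem integral_prod_pow_pi (n : ℕ) (l : Fin n → ℕ) (ω : ThomaSimplex) :
    ∫ x, ∏ i, (x i : ℝ) ^ l i ∂(thomaKernel n ω) = ∏ i, extPowerSum (l i + 1) ω := by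
  rw [thomaKernel_apply]
  have h := integral_fintype_prod_eq_prod (𝕜 := ℝ) (μ := fun _ : Fin n => thomaMeasure ω)
    (fun i (y : Set.Icc (-1 : ℝ) 1) => (y : ℝ) ^ l i)
  rw [h]
  exact Finset.prod_congr rfl fun i _ => integral_pow_thomaMeasure ω (l i)

theorem norm_prod_pow_le_one {n : ℕ} (l : Fin n → ℕ) (x : Fin n → Set.Icc (-1 : ℝ) 1) :
    ‖∏ i, (x i : ℝ) ^ l i‖ ≤ 1 := by
  rw [norm_prod]
  refine Finset.prod_le_one (fun i _ => norm_nonneg _) fun i _ => ?_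
  rw [norm_pow]
  exact pow_le_one₀ (norm_nonneg _) (abs_le.2 (x i).2)

theorem integral_prod_pow_controllingMeasure (P : Measure ThomaSimplex) [IsProbabilityMeasure P]
    (n : ℕ) (l : Fin n → ℕ) : ∫ x, ∏ i, (x i : ℝ) ^ l i ∂(controllingMeasure P n) =
      ∫ ω, ∏ i, extPowerSum (l i + 1) ω ∂P := by
  rw [controllingMeasure_eq_comp, ProbabilityTheory.Kernel.integral_comp]
  · rw [ProbabilityTheory.Kernel.const_apply]
    exact integral_congr_ae (Filter.Eventually.of_forall fun ω => integral_prod_pow_pi n l ω)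
  · refine Integrable.of_bound (Continuous.aestronglyMeasurable (by fun_prop)) 1
      (Filter.Eventually.of_forall (norm_prod_pow_le_one l))

/-- A moment of the kernel with n = 1 depends measurably on ω. -/
theorem measurable_extPowerSum (k : ℕ) :
    Measurable fun ω : ThomaSimplex => extPowerSum (k + 1) ω := by
  have hm : Measurable fun x : Fin 1 → Set.Icc (-1 : ℝ) 1 => ∏ i, (x i : ℝ) ^ (fun _ => k) i :=
    Continuous.measurable (by fun_prop)
  have h := (hm.stronglyMeasurable.integral_kernel (κ := thomaKernel 1)).measurable
  simp only [integral_prod_pow_pi] at h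
  simpa using h

theorem abs_extPowerSum_le_one (k : ℕ) (ω : ThomaSimplex) : |extPowerSum (k + 1) ω| ≤ 1 := by
  rw [← integral_pow_thomaMeasure, ← Real.norm_eq_abs]
  refine (norm_integral_le_of_norm_le_const (C := 1)
    (Filter.Eventually.of_forall fun x => ?_)).trans ?_
  · rw [norm_pow]
    exact pow_le_one₀ (norm_nonneg _) (abs_le.2 x.2)
  · simp

theorem integrable_extend (P : Measure ThomaSimplex) [IsProbabilityMeasure P] (f : SymFun) :
    Integrable (extend f) P := by
  have h : Measurable (extend f) ∧ ∃ C, ∀ ω, ‖extend f ω‖ ≤ C := by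
    induction f using MvPolynomial.induction_on with
    | C a =>
      have : extend (MvPolynomial.C a) = fun _ => a := by
        funext ω
        simp [extend]
      rw [this]
      exact ⟨measurable_const, ‖a‖, fun _ => le_rfl⟩
    | add p q hp hq =>
      have : extend (p + q) = fun ω => extend p ω + extend q ω := by
        funext ω
        simp [extend]
      obtain ⟨hp1, C, hp2⟩ := hp
      obtain ⟨hq1, D, hq2⟩ := hq
      rw [this]
      exact ⟨hp1.add hq1, C + D, fun ω => (norm_add_le _ _).trans (add_le_add (hp2 ω) (hq2 ω))⟩
    | mul_X p k hp =>
      have : extend (p * MvPolynomial.X k) = fun ω => extend p ω * extPowerSum (k + 1) ω := by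
        funext ω
        simp [extend]
      obtain ⟨hp1, C, hp2⟩ := hp
      rw [this]
      refine ⟨hp1.mul (measurable_extPowerSum k), C, fun ω => ?_⟩
      rw [norm_mul]
      exact (mul_le_of_le_one_right (norm_nonneg _) (abs_extPowerSum_le_one k ω)).trans (hp2 ω)
  obtain ⟨h1, C, h2⟩ := h
  exact Integrable.of_bound h1.aestronglyMeasurable C (Filter.Eventually.of_forall h2)

open BoundedContinuousFunction in
/-- A finite measure on the cube is determined by its moments. -/
theorem eq_of_moments_eq {n : ℕ} {μ ν : Measure (Fin n → Set.Icc (-1 : ℝ) 1)}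
    [IsFiniteMeasure μ] [IsFiniteMeasure ν]
    (h : ∀ l : Fin n → ℕ, ∫ x, ∏ i, (x i : ℝ) ^ l i ∂μ = ∫ x, ∏ i, (x i : ℝ) ^ l i ∂ν) :
    μ = ν := by
  let coord : Fin n → ((Fin n → Set.Icc (-1 : ℝ) 1) →ᵇ ℝ) := fun i =>
    BoundedContinuousFunction.mkOfCompact ⟨fun x => (x i : ℝ), by fun_prop⟩
  let B : Subalgebra ℝ ((Fin n → Set.Icc (-1 : ℝ) 1) →ᵇ ℝ) := Algebra.adjoin ℝ (Set.range coord)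
  let A : StarSubalgebra ℝ ((Fin n → Set.Icc (-1 : ℝ) 1) →ᵇ ℝ) :=
    { B with
      star_mem' := fun {a} ha => by
        have : star a = a := by ext x; simp
        rw [this]
        exact ha }
  -- Stone–Weierstrass: the polynomials in the coordinates separate points, and their integrals are
  -- combinations of moments.
  refine ext_of_forall_mem_subalgebra_integral_eq_of_polish (𝕜 := ℝ) (A := A) ?_ ?_
  · intro x y hxy
    obtain ⟨i, hi⟩ := Function.ne_iff.1 hxy
    refine ⟨fun x => (x i : ℝ), ⟨_, ⟨coord i, Algebra.subset_adjoin ⟨i, rfl⟩, rfl⟩, rfl⟩, ?_⟩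
    exact fun he => hi (Subtype.ext he)
  · intro g hg
    have hg' : g ∈ (MvPolynomial.aeval (R := ℝ) coord).range := by
      rw [← Algebra.adjoin_range_eq_range_aeval]
      exact hg
    obtain ⟨p, rfl⟩ := hg'
    clear hg
    have hint : ∀ (ρ : Measure (Fin n → Set.Icc (-1 : ℝ) 1)) [IsFiniteMeasure ρ]
        (g : (Fin n → Set.Icc (-1 : ℝ) 1) →ᵇ ℝ), Integrable g ρ :=
      fun ρ _ g => g.integrable ρ
    change ∫ x, (MvPolynomial.aeval coord p) x ∂μ = ∫ x, (MvPolynomial.aeval coord p) x ∂ν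
    induction p using MvPolynomial.induction_on' with
    | monomial m a =>
      have hm : ∀ x, (MvPolynomial.aeval coord (MvPolynomial.monomial m a)) x =
          a * ∏ i, (x i : ℝ) ^ m i := by
        intro x
        rw [MvPolynomial.aeval_monomial, Finsupp.prod_fintype _ _ (by simp)]
        rw [BoundedContinuousFunction.coe_mul, Pi.mul_apply, BoundedContinuousFunction.coe_prod,
          Finset.prod_apply]
        simp [coord]
      simp only [hm]
      rw [integral_const_mul, integral_const_mul, h]
    | add p q hp hq =>
      simp only [map_add, BoundedContinuousFunction.coe_add, Pi.add_apply]
      rw [integral_add (hint _ _) (hint _ _), integral_add (hint _ _) (hint _ _),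
        hp, hq]

end ThomaSimplex

/-! ### The Frobenius formula and the conclusion. -/

namespace SymmetricGroup

open SymFun

/-- The exponent of `p_{l_1 + 1} ⋯ p_{l_n + 1}`. -/
noncomputable def prodExp {n : ℕ} (l : Fin n → ℕ) : ℕ →₀ ℕ := ∑ i, Finsupp.single (l i) 1

theorem degree_prodExp {n : ℕ} (l : Fin n → ℕ) : (prodExp l).degree = n := by
  rw [prodExp, map_sum, Finset.sum_congr rfl fun i _ => Finsupp.degree_single (l i) 1]
  simp

theorem wt_prodExp {n : ℕ} (l : Fin n → ℕ) : wt (prodExp l) = (∑ i, l i) + n := by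
  rw [prodExp, map_sum, Finset.sum_congr rfl fun i _ => wt_single (l i) 1]
  simp [Finset.sum_add_distrib]

theorem monomial_prodExp {n : ℕ} (l : Fin n → ℕ) :
    MvPolynomial.monomial (prodExp l) (1 : ℝ) = ∏ i, MvPolynomial.X (l i) := by
  rw [prodExp, MvPolynomial.monomial_sum_one]
  rfl

theorem pairing_schur_cycleMonomial {lam : YoungDiagram} (g : BoxPerm lam) :
    pairing (schur lam) (cycleMonomial g) = irrChar lam g := by
  rw [← charMap_irrChar]
  exact pairing_charMap_cycleMonomial (fun _ _ => irrChar_eq_of_isConj) g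

theorem toFinsupp_map_pred {n : ℕ} (l : Fin n → ℕ) :
    Multiset.toFinsupp ((Finset.univ.val.map fun i => l i + 1).map Nat.pred) = prodExp l := by
  rw [Multiset.map_map, prodExp]
  have h : (Finset.univ.val.map (Nat.pred ∘ fun i => l i + 1)) = ∑ i, {l i} :=
    by rw [← Multiset.sum_map_singleton (Finset.univ.val.map _), Multiset.map_map]; rfl
  rw [h, map_sum]
  simp only [Multiset.toFinsupp_singleton]

/-- Parts at least 2 are realized as cycles and the parts 1 as fixed points. This keeps `irrCharAt`
away from its default value 0. -/
theorem exists_perm_partition {X : Type*} [Fintype X] [DecidableEq X] {s : Multiset ℕ}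
    (hpos : ∀ a ∈ s, 0 < a) (hsum : s.sum = Fintype.card X) :
    ∃ g : Equiv.Perm X, g.partition.parts = s := by
  have hsplit := Multiset.filter_add_not (fun a => 2 ≤ a) s
  have hone : s.filter (fun a => ¬ 2 ≤ a) =
      Multiset.replicate (s.filter (fun a => ¬ 2 ≤ a)).card 1 := by
    rw [Multiset.eq_replicate_card]
    intro a ha
    obtain ⟨h1, h2⟩ := Multiset.mem_filter.1 ha
    have := hpos a h1
    omega
  have hs := congrArg Multiset.sum hsplit
  rw [hone, Multiset.sum_add, Multiset.sum_replicate, smul_eq_mul, mul_one, hsum] at hs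
  obtain ⟨g, hg⟩ := (Equiv.Perm.exists_with_cycleType_iff X).2
    ⟨(by omega : (s.filter fun a => 2 ≤ a).sum ≤ Fintype.card X),
      fun a ha => (Multiset.mem_filter.1 ha).2⟩
  refine ⟨g, ?_⟩
  rw [Equiv.Perm.parts_partition, ← Equiv.Perm.sum_cycleType, hg]
  conv_rhs => rw [← hsplit, hone]
  congr 2
  omega

theorem irrCharAt_eq_pairing {lam : YoungDiagram} {n : ℕ} {l : Fin n → ℕ}
    (h : lam.card = (∑ i, l i) + n) :
    irrCharAt lam (Finset.univ.val.map fun i => l i + 1) =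
      pairing (schur lam) (MvPolynomial.monomial (prodExp l) 1) := by
  obtain ⟨g, hg⟩ := exists_perm_partition (X := lam.cells)
    (s := Finset.univ.val.map fun i => l i + 1)
    (fun a ha => by
      obtain ⟨i, -, rfl⟩ := Multiset.mem_map.1 ha
      exact Nat.succ_pos _)
    (by
      rw [Fintype.card_coe]
      change ∑ i, (l i + 1) = lam.card
      rw [h, Finset.sum_add_distrib]
      simp)
  rw [← hg, irrCharAt_eq, ← pairing_schur_cycleMonomial, cycleMonomial,
    ← Equiv.Perm.toFinsupp_parts_partition, hg, toFinsupp_map_pred]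

/-- The Frobenius formula, restricted to the diagrams with at most `n` diagonal boxes. -/
theorem prod_X_eq_sum {n : ℕ} (l : Fin n → ℕ) :
    (∏ i, MvPolynomial.X (l i) : SymFun) =
      ∑ lam ∈ (YoungGraph.level ((∑ i, l i) + n)).filter
        (fun lam => YoungGraph.diagLen lam ≤ n),
        irrCharAt lam (Finset.univ.val.map fun i => l i + 1) • schur lam := by
  rw [← monomial_prodExp, monomial_eq_sum_schur (wt_prodExp l), Finset.sum_filter]
  refine Finset.sum_congr rfl fun lam hlam => ?_
  split_ifs with hd
  · rw [irrCharAt_eq_pairing (YoungGraph.mem_level.1 hlam)]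
  · rw [pairing_schur_monomial_of_degree_lt (by rw [degree_prodExp]; omega), zero_smul]

end SymmetricGroup

/-- `extend` is an algebra homomorphism at each ω, so the Frobenius formula holds pointwise on Ω;
the finite sum is then integrated using the spectral representation. -/
theorem integral_prod_extPowerSum {M : YoungDiagram → ℝ} {P : Measure ThomaSimplex}
    (hP : IsSpectralMeasure M P) {n : ℕ} (l : Fin n → ℕ) :
    ∫ ω, ∏ i, ThomaSimplex.extPowerSum (l i + 1) ω ∂P
          = ∑ lam ∈ (YoungGraph.level ((∑ i, l i) + n)).filter
                (fun lam => YoungGraph.diagLen lam ≤ n),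
              SymmetricGroup.irrCharAt lam (Finset.univ.val.map fun i => l i + 1)
                * (M lam / (YoungGraph.dim lam : ℝ)) := by
  have := hP.isProb
  have h : ∀ ω, ∏ i, ThomaSimplex.extPowerSum (l i + 1) ω =
      ∑ lam ∈ (YoungGraph.level ((∑ i, l i) + n)).filter
        (fun lam => YoungGraph.diagLen lam ≤ n),
        SymmetricGroup.irrCharAt lam (Finset.univ.val.map fun i => l i + 1) *
          ThomaSimplex.extend (SymFun.schur lam) ω := by
    intro ω
    have h1 := congrArg (fun f => ThomaSimplex.extend f ω) (SymmetricGroup.prod_X_eq_sum l)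
    simpa only [ThomaSimplex.extend, map_prod, map_sum, map_smul, MvPolynomial.aeval_X,
      smul_eq_mul] using h1
  simp only [h]
  rw [integral_finsetSum _ fun lam _ => (ThomaSimplex.integrable_extend P _).const_mul _]
  refine Finset.sum_congr rfl fun lam _ => ?_
  rw [integral_const_mul, hP.repr]

theorem proposition3p2 (M : YoungDiagram → ℝ) (hM : YoungGraph.IsCoherentSystem M)
    (P : MeasureTheory.Measure ThomaSimplex) (hP : IsSpectralMeasure M P) (n : ℕ) :
    MeasureTheory.IsProbabilityMeasure (ThomaSimplex.controllingMeasure P n) ∧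
    (∀ l : Fin n → ℕ,
      ∫ x, ∏ i, (x i : ℝ) ^ l i ∂(ThomaSimplex.controllingMeasure P n)
          = ∫ ω, ∏ i, ThomaSimplex.extPowerSum (l i + 1) ω ∂P ∧
      ∫ ω, ∏ i, ThomaSimplex.extPowerSum (l i + 1) ω ∂P
          = ∑ lam ∈ (YoungGraph.level ((∑ i, l i) + n)).filter
                (fun lam => YoungGraph.diagLen lam ≤ n),
              SymmetricGroup.irrCharAt lam (Finset.univ.val.map fun i => l i + 1)
                * (M lam / (YoungGraph.dim lam : ℝ))) ∧
    (∀ (M' : YoungDiagram → ℝ) (P' : MeasureTheory.Measure ThomaSimplex),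
      YoungGraph.IsCoherentSystem M' → IsSpectralMeasure M' P' →
      (∀ lam : YoungDiagram, YoungGraph.diagLen lam ≤ n → M' lam = M lam) →
      ThomaSimplex.controllingMeasure P' n = ThomaSimplex.controllingMeasure P n) := by
  have := hP.isProb
  have hprob := ThomaSimplex.isProbabilityMeasure_controllingMeasure P n
  refine ⟨hprob, fun l => ⟨ThomaSimplex.integral_prod_pow_controllingMeasure P n l,
    integral_prod_extPowerSum hP l⟩, fun M' P' _ hP' hMM' => ?_⟩
  have := hP'.isProb
  have hprob' := ThomaSimplex.isProbabilityMeasure_controllingMeasure P' n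
  refine ThomaSimplex.eq_of_moments_eq fun l => ?_
  rw [ThomaSimplex.integral_prod_pow_controllingMeasure,
    ThomaSimplex.integral_prod_pow_controllingMeasure, integral_prod_extPowerSum hP,
    integral_prod_extPowerSum hP']
  refine Finset.sum_congr rfl fun lam hlam => ?_
  rw [hMM' lam (Finset.mem_filter.1 hlam).2]
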